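/- Let $\mathcal G$ be the star graph consisting of $N\ge 1$ half-lines $(0,\infty)$ attached to a common vertex $0$, let $\mu>0$, $\alpha<0$ and $\omega>\alpha^2/N^2$, and let $L^2_{\mathbb R}(\mathcal G)=\bigoplus_{k=1}^N L^2(\mathbb R^+,\mathbb R)$. Put $$\phi_s(x)=[(\mu+1)\omega]^{\frac1{2\mu}}\,\mathrm{sech}^{\frac1\mu}(\mu\sqrt\omega\,x),\qquad a_0=\frac1{\mu\sqrt\omega}\,\mathrm{arctanh}\Big(\frac{-\alpha}{N\sqrt\omega}\Big),\qquad (\Psi_{\omega,0})_k(x)=\phi_s(x+a_0),\quad k=1,\dots,N,$$ and $$\mathcal D(H)=\Big\{\Psi=(\psi_1,\dots,\psi_N)\in \bigoplus_{k=1}^N H^2(\mathbb R^+,\mathbb R):\ \psi_1(0)=\dots=\psi_N(0),\ \sum_{k=1}^N\psi_k'(0)=\alpha\,\psi_1(0)\Big\}.$$ On the domain $\mathcal D(\mathcal L_\pm)=\mathcal D(H)$ define the operators $\mathcal L_\pm$ in $L^2_{\mathbb R}(\mathcal G)$ by $$(\mathcal L_+\Psi)_k=-\psi_k''+\omega\psi_k-|(\Psi_{\omega,0})_k|^{2\mu}\psi_k,\qquad(\mathcal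 L_-\Psi)_k=-\psi_k''+\omega\psi_k-(2\mu+1)|(\Psi_{\omega,0})_k|^{2\mu}\psi_k .$$ Then $\mathcal L_-$ and $\mathcal L_+$ are self-adjoint. Moreover: 1. $\ker\mathcal L_+$ is the line spanned by $\Psi_{\omega,0}$, and every other point of the spectrum of $\mathcal L_+$ is positive; 2. $\ker\mathcal L_-=\{0\}$; 3. $n(\mathcal L_-)=1$, where $n(A)$ is the number of negative eigenvalues of $A$ counted with multiplicity. That is, $\mathcal L_-$ has exactly one negative eigenvalue, and it is simple. -/

import Mathlib

open MeasureTheory Set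
open scoped ENNReal

noncomputable section

namespace StarGraph

/-- Lebesgue measure on the open half line `(0, ∞)`, i.e. on one edge of the graph. -/
abbrev halfLine : Measure ℝ := volume.restrict (Ioi (0 : ℝ))

/-- The real Hilbert space `L²(ℝ⁺)`. -/
abbrev EdgeL2 : Type := Lp ℝ 2 halfLine

/-- The real Hilbert space `L²(𝒢, ℝ) = ⊕ⱼ L²(ℝ⁺)` of a star graph with `N` infinite edges
(Hilbert direct sum). -/
abbrev GraphL2 (N : ℕ) : Type := PiLp 2 (fun _ : Fin N => EdgeL2)

/-- `g ∈ L²(ℝ⁺)` is the weak derivative of `f ∈ L²(ℝ⁺)` on the open half line. -/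
def HasWeakDeriv (f g : EdgeL2) : Prop :=
  ∀ η : ℝ → ℝ, ContDiff ℝ ((⊤ : ℕ∞) : WithTop ℕ∞) η → HasCompactSupport η → tsupport η ⊆ Ioi 0 →
    ∫ x in Ioi (0 : ℝ), f x * deriv η x = - ∫ x in Ioi (0 : ℝ), g x * η x

/-- `c` is the value at the vertex `x = 0` of (the representative of `f` that is continuous on
`[0, ∞)`). -/
def HasVertexValue (f : EdgeL2) (c : ℝ) : Prop :=
  ∃ u : ℝ → ℝ, ContinuousOn u (Ici 0) ∧ f =ᵐ[halfLine] u ∧ u 0 = c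

lemma integrable_mul_test (f : EdgeL2) {η : ℝ → ℝ} (hη : Continuous η)
    (hs : HasCompactSupport η) : Integrable (fun x => f x * η x) halfLine :=
  (Lp.memLp f).integrable_mul (hη.memLp_of_hasCompactSupport (p := 2) hs)

lemma HasWeakDeriv.add {f g f' g' : EdgeL2} (hf : HasWeakDeriv f f') (hg : HasWeakDeriv g g') :
    HasWeakDeriv (f + g) (f' + g') := by
  intro η h1 h2 h3
  have hd : Continuous (deriv η) := h1.continuous_deriv (by simp)
  have e1 : ∫ x in Ioi (0 : ℝ), (f + g : EdgeL2) x * deriv η x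
      = (∫ x in Ioi (0 : ℝ), f x * deriv η x) + ∫ x in Ioi (0 : ℝ), g x * deriv η x := by
    rw [← integral_add (integrable_mul_test f hd h2.deriv) (integrable_mul_test g hd h2.deriv)]
    apply integral_congr_ae
    filter_upwards [Lp.coeFn_add f g] with x hx
    rw [hx, Pi.add_apply, add_mul]
  have e2 : ∫ x in Ioi (0 : ℝ), (f' + g' : EdgeL2) x * η x
      = (∫ x in Ioi (0 : ℝ), f' x * η x) + ∫ x in Ioi (0 : ℝ), g' x * η x := by
    rw [← integral_add (integrable_mul_test f' h1.continuous h2)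
      (integrable_mul_test g' h1.continuous h2)]
    apply integral_congr_ae
    filter_upwards [Lp.coeFn_add f' g'] with x hx
    rw [hx, Pi.add_apply, add_mul]
  rw [e1, e2, hf η h1 h2 h3, hg η h1 h2 h3, neg_add]

lemma HasWeakDeriv.smul {f f' : EdgeL2} (hf : HasWeakDeriv f f') (r : ℝ) :
    HasWeakDeriv (r • f) (r • f') := by
  intro η h1 h2 h3
  have e : ∀ (h : EdgeL2) (θ : ℝ → ℝ), ∫ x in Ioi (0 : ℝ), (r • h : EdgeL2) x * θ x
      = r * ∫ x in Ioi (0 : ℝ), h x * θ x := by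
    intro h θ
    rw [← integral_const_mul]
    apply integral_congr_ae
    filter_upwards [Lp.coeFn_smul r h] with x hx
    rw [hx, Pi.smul_apply, smul_eq_mul, mul_assoc]
  rw [e, e, hf η h1 h2 h3, mul_neg]

lemma HasWeakDeriv.unique {f g g' : EdgeL2} (h : HasWeakDeriv f g) (h' : HasWeakDeriv f g') :
    g = g' := by
  have hloc : LocallyIntegrableOn (fun x => g x - g' x) (Ioi (0 : ℝ)) := by
    have hm : MemLp (fun x => g x - g' x) 2 halfLine := (Lp.memLp g).sub (Lp.memLp g')
    exact locallyIntegrableOn_of_locallyIntegrable_restrict (hm.locallyIntegrable (by norm_num))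
  have key := isOpen_Ioi.ae_eq_zero_of_integral_contDiff_smul_eq_zero hloc (fun η h1 h2 h3 => by
    have e : (∫ x, η x • (g x - g' x)) = ∫ x in Ioi (0 : ℝ), η x • (g x - g' x) := by
      symm
      apply setIntegral_eq_integral_of_forall_compl_eq_zero
      intro x hx
      have : η x = 0 := by
        by_contra hne
        exact hx (h3 (subset_tsupport η hne))
      simp [this]
    have e2 : ∫ x in Ioi (0 : ℝ), η x • (g x - g' x)
        = (∫ x in Ioi (0 : ℝ), g x * η x) - ∫ x in Ioi (0 : ℝ), g' x * η x := by
      rw [← integral_sub (integrable_mul_test g h1.continuous h2)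
        (integrable_mul_test g' h1.continuous h2)]
      apply integral_congr_ae
      filter_upwards with x
      simp only [smul_eq_mul]
      ring
    rw [e, e2]
    have a1 := h η h1 h2 h3
    have a2 := h' η h1 h2 h3
    linarith)
  apply Lp.ext
  have := (ae_restrict_iff' (μ := volume) (measurableSet_Ioi (a := (0 : ℝ)))
    (p := fun x => g x - g' x = 0)).2 key
  filter_upwards [this] with x hx
  linarith

lemma HasVertexValue.add {f g : EdgeL2} {c d : ℝ} (hf : HasVertexValue f c)
    (hg : HasVertexValue g d) : HasVertexValue (f + g) (c + d) := by
  obtain ⟨u, hu, hfu, rfl⟩ := hf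
  obtain ⟨v, hv, hgv, rfl⟩ := hg
  refine ⟨u + v, hu.add hv, ?_, rfl⟩
  exact (Lp.coeFn_add f g).trans (hfu.add hgv)

lemma HasVertexValue.smul {f : EdgeL2} {c : ℝ} (hf : HasVertexValue f c) (r : ℝ) :
    HasVertexValue (r • f) (r * c) := by
  obtain ⟨u, hu, hfu, rfl⟩ := hf
  refine ⟨r • u, hu.const_smul r, ?_, rfl⟩
  exact (Lp.coeFn_smul r f).trans (hfu.const_smul r)

/-- `Ψ ∈ H²(𝒢)` with first weak derivative `Ψ'`, second weak derivative `Ψ''`, and the vertex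
conditions of the delta interaction of strength `α`:
`ψ₁(0) = … = ψ_N(0) = c` and `∑ᵢ ψᵢ'(0) = α c`. -/
def IsDeltaData {N : ℕ} (α : ℝ) (Ψ Ψ' Ψ'' : GraphL2 N) : Prop :=
  (∀ i, HasWeakDeriv (Ψ i) (Ψ' i)) ∧ (∀ i, HasWeakDeriv (Ψ' i) (Ψ'' i)) ∧
    ∃ (c : ℝ) (d : Fin N → ℝ), (∀ i, HasVertexValue (Ψ i) c) ∧
      (∀ i, HasVertexValue (Ψ' i) (d i)) ∧ ∑ i, d i = α * c

lemma IsDeltaData.add {N : ℕ} {α : ℝ} {Ψ Ψ' Ψ'' Φ Φ' Φ'' : GraphL2 N}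
    (h : IsDeltaData α Ψ Ψ' Ψ'') (k : IsDeltaData α Φ Φ' Φ'') :
    IsDeltaData α (Ψ + Φ) (Ψ' + Φ') (Ψ'' + Φ'') := by
  obtain ⟨h1, h2, c, d, h3, h4, h5⟩ := h
  obtain ⟨k1, k2, c', d', k3, k4, k5⟩ := k
  refine ⟨fun i => (h1 i).add (k1 i), fun i => (h2 i).add (k2 i), c + c', d + d',
    fun i => (h3 i).add (k3 i), fun i => (h4 i).add (k4 i), ?_⟩
  simp only [Pi.add_apply, Finset.sum_add_distrib, h5, k5, mul_add]

lemma IsDeltaData.smul {N : ℕ} {α : ℝ} {Ψ Ψ' Ψ'' : GraphL2 N}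
    (h : IsDeltaData α Ψ Ψ' Ψ'') (r : ℝ) : IsDeltaData α (r • Ψ) (r • Ψ') (r • Ψ'') := by
  obtain ⟨h1, h2, c, d, h3, h4, h5⟩ := h
  refine ⟨fun i => (h1 i).smul r, fun i => (h2 i).smul r, r * c, fun i => r * d i,
    fun i => (h3 i).smul r, fun i => (h4 i).smul r, ?_⟩
  rw [← Finset.mul_sum, h5]
  ring

lemma IsDeltaData.unique {N : ℕ} {α : ℝ} {Ψ Ψ' Ψ'' Φ' Φ'' : GraphL2 N}
    (h : IsDeltaData α Ψ Ψ' Ψ'') (k : IsDeltaData α Ψ Φ' Φ'') : Ψ'' = Φ'' := by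
  have e : Ψ' = Φ' := PiLp.ext fun i => (h.1 i).unique (k.1 i)
  subst e
  exact PiLp.ext fun i => (h.2.1 i).unique (k.2.1 i)

lemma isDeltaData_zero (N : ℕ) (α : ℝ) : IsDeltaData α (0 : GraphL2 N) 0 0 := by
  have w : HasWeakDeriv 0 0 := by
    intro η _ _ _
    have e : ∀ θ : ℝ → ℝ, ∫ x in Ioi (0 : ℝ), (0 : EdgeL2) x * θ x = 0 := by
      intro θ
      apply integral_eq_zero_of_ae
      filter_upwards [Lp.coeFn_zero ℝ 2 halfLine] with x hx
      rw [hx, Pi.zero_apply, zero_mul]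
    rw [e, e, neg_zero]
  have b : HasVertexValue 0 0 := ⟨0, continuousOn_const, Lp.coeFn_zero ℝ 2 halfLine, rfl⟩
  exact ⟨fun _ => w, fun _ => w, 0, fun _ => 0, fun _ => b, fun _ => b, by simp⟩

/-- The domain `𝒟(H)` of the Hamiltonian with a delta vertex of strength `α`. -/
def deltaDomain (N : ℕ) (α : ℝ) : Submodule ℝ (GraphL2 N) where
  carrier := {Ψ | ∃ Ψ' Ψ'', IsDeltaData α Ψ Ψ' Ψ''}
  add_mem' := by
    rintro _ _ ⟨_, _, h⟩ ⟨_, _, k⟩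
    exact ⟨_, _, h.add k⟩
  zero_mem' := ⟨_, _, isDeltaData_zero N α⟩
  smul_mem' := by
    rintro r _ ⟨_, _, h⟩
    exact ⟨_, _, h.smul r⟩

lemma exists_secondDeriv {N : ℕ} {α : ℝ} (Ψ : deltaDomain N α) :
    ∃ Ψ'' : GraphL2 N, ∃ Ψ' : GraphL2 N, IsDeltaData α (Ψ : GraphL2 N) Ψ' Ψ'' := by
  obtain ⟨Ψ', Ψ'', h⟩ := Ψ.2
  exact ⟨Ψ'', Ψ', h⟩

/-- The second weak derivative `Ψ''` of an element `Ψ` of `𝒟(H)`. -/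
def secondDeriv {N : ℕ} {α : ℝ} (Ψ : deltaDomain N α) : GraphL2 N :=
  (exists_secondDeriv Ψ).choose

lemma secondDeriv_eq {N : ℕ} {α : ℝ} (Ψ : deltaDomain N α) {Ψ' Ψ'' : GraphL2 N}
    (h : IsDeltaData α (Ψ : GraphL2 N) Ψ' Ψ'') : secondDeriv Ψ = Ψ'' := by
  obtain ⟨_, k⟩ := (exists_secondDeriv Ψ).choose_spec
  exact k.unique h

/-- The Hamiltonian `H` with a delta vertex of strength `α`: `H Ψ = (-ψ₁'', …, -ψ_N'')` on
`𝒟(H)`. -/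
def hamiltonian (N : ℕ) (α : ℝ) : GraphL2 N →ₗ.[ℝ] GraphL2 N where
  domain := deltaDomain N α
  toFun :=
    { toFun := fun Ψ => - secondDeriv Ψ
      map_add' := by
        intro Ψ Φ
        obtain ⟨_, h⟩ := (exists_secondDeriv Ψ).choose_spec
        obtain ⟨_, k⟩ := (exists_secondDeriv Φ).choose_spec
        rw [secondDeriv_eq (Ψ + Φ) (h.add k), neg_add]
        rfl
      map_smul' := by
        intro r Ψ
        obtain ⟨_, h⟩ := (exists_secondDeriv Ψ).choose_spec
        rw [secondDeriv_eq (r • Ψ) (h.smul r), RingHom.id_apply, smul_neg]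
        rfl }

/-- The soliton profile `φ_s(x) = [(μ+1)ω]^{1/(2μ)} sech^{1/μ}(μ √ω x)`. -/
def soliton (μ ω x : ℝ) : ℝ :=
  ((μ + 1) * ω) ^ (1 / (2 * μ)) * (1 / Real.cosh (μ * √ω * x)) ^ (1 / μ)

/-- The translation parameter of the `N`-tail state,
`a₀ = (μ √ω)⁻¹ artanh(α / ((0 - N) √ω))`. -/
def tailShift (N : ℕ) (α ω μ : ℝ) : ℝ :=
  1 / (μ * √ω) * Real.artanh (α / ((0 - (N : ℝ)) * √ω))

/-- The components `(Ψ_{ω,0})_k(x) = φ_s(x + a₀)` of the ground state, as functions. -/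
def groundStateFun (N : ℕ) (α ω μ : ℝ) (_k : Fin N) (x : ℝ) : ℝ :=
  soliton μ ω (x + tailShift N α ω μ)

lemma continuous_soliton {μ : ℝ} (hμ : 0 < μ) (ω : ℝ) : Continuous (soliton μ ω) := by
  unfold soliton
  refine continuous_const.mul (Continuous.rpow_const ?_ (fun x => Or.inr (by positivity)))
  exact continuous_const.div (by fun_prop) (fun x => (Real.cosh_pos _).ne')

lemma continuous_groundStateFun (N : ℕ) (α ω : ℝ) {μ : ℝ} (hμ : 0 < μ) (k : Fin N) :
    Continuous (groundStateFun N α ω μ k) :=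
  (continuous_soliton hμ ω).comp (by fun_prop)

lemma abs_soliton_le {μ : ℝ} (hμ : 0 < μ) (ω x : ℝ) :
    |soliton μ ω x| ≤ |((μ + 1) * ω) ^ (1 / (2 * μ))| := by
  have hc := Real.one_le_cosh (μ * √ω * x)
  have h0 : 0 ≤ 1 / Real.cosh (μ * √ω * x) := by positivity
  have h1 : 1 / Real.cosh (μ * √ω * x) ≤ 1 := by
    rw [div_le_one (by linarith)]; exact hc
  unfold soliton
  rw [abs_mul, abs_of_nonneg (Real.rpow_nonneg h0 _)]
  exact mul_le_of_le_one_right (abs_nonneg _) (Real.rpow_le_one h0 h1 (by positivity))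

lemma memLp_groundStateFun (N : ℕ) (α : ℝ) {ω μ : ℝ} (hω : 0 < ω) (hμ : 0 < μ) (k : Fin N) :
    MemLp (groundStateFun N α ω μ k) 2 halfLine := by
  set a := tailShift N α ω μ with ha
  set C := ((μ + 1) * ω) ^ (1 / (2 * μ)) * ((2 : ℝ) ^ (1 / μ) * Real.exp (-√ω * a)) with hC
  have hs : 0 < √ω := Real.sqrt_pos.2 hω
  have hg : MemLp (fun x => C * Real.exp (-√ω * x)) 2 halfLine := by
    refine MemLp.const_mul ?_ C
    have hm : AEStronglyMeasurable (fun x => Real.exp (-√ω * x)) halfLine :=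
      (by fun_prop : Continuous fun x => Real.exp (-√ω * x)).aestronglyMeasurable
    rw [memLp_two_iff_integrable_sq hm]
    have := exp_neg_integrableOn_Ioi 0 (b := 2 * √ω) (by positivity)
    refine this.congr ?_
    filter_upwards with x
    rw [← Real.exp_nat_mul]
    congr 1
    push_cast
    ring
  refine hg.mono (continuous_groundStateFun N α ω hμ k).aestronglyMeasurable ?_
  filter_upwards with x
  have hb : 0 ≤ ((μ + 1) * ω) ^ (1 / (2 * μ)) := by positivity
  have hle : 1 / Real.cosh (μ * √ω * (x + a)) ≤ 2 * Real.exp (-(μ * √ω * (x + a))) := by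
    rw [div_le_iff₀ (Real.cosh_pos _), Real.cosh_eq, Real.exp_neg]
    have := Real.exp_pos (μ * √ω * (x + a))
    field_simp
    nlinarith [sq_nonneg (Real.exp (μ * √ω * (x + a)))]
  have hpow : (1 / Real.cosh (μ * √ω * (x + a))) ^ (1 / μ)
      ≤ (2 : ℝ) ^ (1 / μ) * Real.exp (-√ω * a) * Real.exp (-√ω * x) := by
    refine (Real.rpow_le_rpow (by positivity) hle (by positivity)).trans (le_of_eq ?_)
    rw [Real.mul_rpow (by norm_num) (Real.exp_pos _).le, ← Real.exp_mul, mul_assoc (2 ^ (1 / μ) : ℝ),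
      ← Real.exp_add]
    congr 2
    field_simp
    ring
  have hnn : 0 ≤ groundStateFun N α ω μ k x := by
    unfold groundStateFun soliton
    positivity
  rw [Real.norm_of_nonneg hnn]
  refine le_trans ?_ (le_abs_self _)
  unfold groundStateFun soliton
  rw [← ha, hC]
  calc _ ≤ ((μ + 1) * ω) ^ (1 / (2 * μ))
        * ((2 : ℝ) ^ (1 / μ) * Real.exp (-√ω * a) * Real.exp (-√ω * x)) :=
        mul_le_mul_of_nonneg_left hpow hb
    _ = _ := by ring

/-- The ground state `Ψ_{ω,0}` as an element of `L²(𝒢)`. -/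
def groundState (N : ℕ) (α : ℝ) {ω μ : ℝ} (hω : 0 < ω) (hμ : 0 < μ) : GraphL2 N :=
  WithLp.toLp 2 fun k => (memLp_groundStateFun N α hω hμ k).toLp (groundStateFun N α ω μ k)

lemma memLp_potential (N : ℕ) (α ω : ℝ) {μ : ℝ} (hμ : 0 < μ) (k : Fin N) :
    MemLp (fun x => |groundStateFun N α ω μ k x| ^ (2 * μ)) ∞ halfLine := by
  have hc : Continuous (fun x => |groundStateFun N α ω μ k x| ^ (2 * μ)) :=
    (continuous_groundStateFun N α ω hμ k).abs.rpow_const fun x => Or.inr (by positivity)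
  refine memLp_top_of_bound hc.aestronglyMeasurable
    (|((μ + 1) * ω) ^ (1 / (2 * μ))| ^ (2 * μ)) ?_
  filter_upwards with x
  rw [Real.norm_of_nonneg (by positivity)]
  exact Real.rpow_le_rpow (abs_nonneg _) (abs_soliton_le hμ ω _) (by positivity)

/-- The bounded potential `|(Ψ_{ω,0})_k|^{2μ}` on the `k`-th edge. -/
def potential (N : ℕ) (α ω : ℝ) {μ : ℝ} (hμ : 0 < μ) (k : Fin N) : Lp ℝ ∞ halfLine :=
  (memLp_potential N α ω hμ k).toLp _

/-- The product `V f ∈ L²(ℝ⁺)` of a bounded function `V` and `f ∈ L²(ℝ⁺)`. -/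
def edgeMul (V : Lp ℝ ∞ halfLine) : EdgeL2 →ₗ[ℝ] EdgeL2 where
  toFun f := V • f
  map_add' f g := Lp.add_smul V f g
  map_smul' r f := (Lp.smul_comm r V f).symm

lemma coeFn_edgeMul (V : Lp ℝ ∞ halfLine) (f : EdgeL2) :
    edgeMul V f =ᵐ[halfLine] fun x => V x * f x :=
  Lp.coeFn_lpSMul V f

/-- Multiplication by `|Ψ_{ω,0}|^{2μ}`, edge by edge: the `k`-th component of the image of `Ψ` is
`|(Ψ_{ω,0})_k|^{2μ} ψ_k`. -/
def potentialMul (N : ℕ) (α ω : ℝ) {μ : ℝ} (hμ : 0 < μ) : GraphL2 N →ₗ[ℝ] GraphL2 N where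
  toFun Ψ := WithLp.toLp 2 fun k => edgeMul (potential N α ω hμ k) (Ψ k)
  map_add' Ψ Φ := PiLp.ext fun k => (edgeMul (potential N α ω hμ k)).map_add (Ψ k) (Φ k)
  map_smul' r Ψ := PiLp.ext fun k => (edgeMul (potential N α ω hμ k)).map_smul r (Ψ k)

/-- The operator `H + ω - κ |Ψ_{ω,0}|^{2μ}` on the domain `𝒟(H)`. -/
def linearized (N : ℕ) (α ω : ℝ) {μ : ℝ} (hμ : 0 < μ) (κ : ℝ) : GraphL2 N →ₗ.[ℝ] GraphL2 N where
  domain := (hamiltonian N α).domain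
  toFun := (hamiltonian N α).toFun + ω • (hamiltonian N α).domain.subtype
    - κ • (potentialMul N α ω hμ ∘ₗ (hamiltonian N α).domain.subtype)

/-- `(ℒ₊)_{ik} = (-d²/dx² + ω - |(Ψ_{ω,0})_k|^{2μ}) δ_{ik}` on `𝒟(H)`. -/
def Lplus (N : ℕ) (α ω : ℝ) {μ : ℝ} (hμ : 0 < μ) : GraphL2 N →ₗ.[ℝ] GraphL2 N :=
  linearized N α ω hμ 1

/-- `(ℒ₋)_{ik} = (-d²/dx² + ω - (2μ+1) |(Ψ_{ω,0})_k|^{2μ}) δ_{ik}` on `𝒟(H)`. -/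
def Lminus (N : ℕ) (α ω : ℝ) {μ : ℝ} (hμ : 0 < μ) : GraphL2 N →ₗ.[ℝ] GraphL2 N :=
  linearized N α ω hμ (2 * μ + 1)

section Spectral

variable {E : Type*} [NormedAddCommGroup E] [NormedSpace ℝ E]

/-- The space `{x ∈ 𝒟(A) | A x = t x}`, as a subspace of the ambient space. -/
def eigenspace (A : E →ₗ.[ℝ] E) (t : ℝ) : Submodule ℝ E :=
  (LinearMap.ker (A.toFun - t • A.domain.subtype)).map A.domain.subtype

/-- The kernel of the operator `A`. -/
def opKernel (A : E →ₗ.[ℝ] E) : Submodule ℝ E :=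
  (LinearMap.ker A.toFun).map A.domain.subtype

/-- The resolvent set of a possibly unbounded operator: `A - t : 𝒟(A) → E` has a bounded
everywhere defined two-sided inverse `R`. -/
def resolventSet (A : E →ₗ.[ℝ] E) : Set ℝ :=
  {t | ∃ R : E →L[ℝ] E, (∀ y, ∃ h : R y ∈ A.domain, A ⟨R y, h⟩ - t • R y = y) ∧
    ∀ x : A.domain, R (A x - t • (x : E)) = x}

/-- The spectrum of a possibly unbounded operator. -/
def opSpectrum (A : E →ₗ.[ℝ] E) : Set ℝ := (resolventSet A)ᶜ

/-- The number of negative eigenvalues of `A` counted with multiplicity (an infinite cardinal if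
there are infinitely many). Eigenspaces of distinct eigenvalues are linearly independent, so this
is the dimension of the span of the eigenspaces with negative eigenvalue. -/
def morseIndex (A : E →ₗ.[ℝ] E) : Cardinal :=
  Module.rank ℝ (⨆ t : Iio (0 : ℝ), eigenspace A t : Submodule ℝ E)

end Spectral

end StarGraph

end

/-! On each edge both operators are Schrödinger operators `-d²/dx² + Q` with an explicit positive
square integrable solution `h` of `-h'' + Q h = 0`. For `ℒ₊` it is the soliton tail `φ` itself. For
`ℒ₋` it is `-φ'` up to a positive factor, by differentiating the soliton equation; it is positive on
the whole edge because `α < 0` makes the shift `a₀` positive. With `ρ = h'/h`, Jacobi's identity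
turns the quadratic form into `∑ ∫ (ψ_k' - ρ ψ_k)² + c² (α - N ρ(0))`, where `c` is the vertex value
(`IsRiccati.integral_form`, `linearized_form`).

For `ℒ₊` the vertex condition of the ground state says exactly `α = N ρ(0)`, so the form is
nonnegative and negative reals lie in the resolvent set (`mem_resolventSet_of_neg`). For `ℒ₋` the
number `α - N ρ(0)` is negative. The form is still nonnegative on the hyperplane `c = 0`, but
negative at the ground state `Ψ`, because `ℒ₋ Ψ = -2μ |Ψ|^{2μ} Ψ`. An abstract variational argument
(`morseIndex_eq_one`) converts this into exactly one simple negative eigenvalue.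

Kernels: by constancy of the Wronskian, square integrable solutions on an edge are multiples of `h`
(`IsRiccati.eq_of_solution`). Thus a kernel element is determined by `c`, and the derivative
condition becomes `c (α - N ρ(0)) = 0`.

Self-adjointness: Green's formula gives symmetry. Conversely, the adjoint relation tested against
smooth functions on a single edge gives `H²` regularity, and tested against functions with arbitrary
vertex data it gives the vertex conditions (`exists_isDeltaData_of_inner`). -/

noncomputable section

namespace StarGraph

open Filter Topology

/-! ### Absolutely continuous functions on the closed half line -/

section

open intervalIntegral

/-- `u` is a primitive of the locally integrable function `g` on `[0, ∞)`. -/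
structure IsPrimitive (u g : ℝ → ℝ) : Prop where
  intervalIntegrable : ∀ b, 0 ≤ b → IntervalIntegrable g volume 0 b
  eq_add : ∀ b, 0 ≤ b → u b = u 0 + ∫ t in (0 : ℝ)..b, g t

namespace IsPrimitive

variable {u v g h : ℝ → ℝ}

lemma add (hu : IsPrimitive u g) (hv : IsPrimitive v h) :
    IsPrimitive (fun x => u x + v x) (fun x => g x + h x) := by
  refine ⟨fun b hb => (hu.1 b hb).add (hv.1 b hb), fun b hb => ?_⟩
  rw [integral_add (hu.1 b hb) (hv.1 b hb), hu.2 b hb, hv.2 b hb]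
  ring

lemma const_mul (c : ℝ) (hu : IsPrimitive u g) :
    IsPrimitive (fun x => c * u x) (fun x => c * g x) := by
  refine ⟨fun b hb => (hu.1 b hb).const_mul c, fun b hb => ?_⟩
  rw [intervalIntegral.integral_const_mul, hu.2 b hb]
  ring

lemma sub (hu : IsPrimitive u g) (hv : IsPrimitive v h) :
    IsPrimitive (fun x => u x - v x) (fun x => g x - h x) := by
  have := hu.add (hv.const_mul (-1))
  simpa [sub_eq_add_neg] using this

lemma mul (hu : IsPrimitive u g) (hv : IsPrimitive v h) :
    IsPrimitive (fun x => u x * v x) (fun x => g x * v x + u x * h x) := by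
  -- Nothing is known about `w` on the negative axis, so `w` is replaced by the explicit integral,
  -- which is absolutely continuous with a.e. derivative `k`; integration by parts for absolutely
  -- continuous functions then applies.
  have key : ∀ {w k : ℝ → ℝ}, IsPrimitive w k → ∀ b, 0 ≤ b →
      AbsolutelyContinuousOnInterval (fun x => w 0 + ∫ t in (0 : ℝ)..x, k t) 0 b ∧
      (∀ x ∈ uIcc 0 b, w x = w 0 + ∫ t in (0 : ℝ)..x, k t) ∧
      ContinuousOn w (uIcc 0 b) ∧
      ∀ᵐ x, x ∈ uIcc 0 b → deriv (fun x => w 0 + ∫ t in (0 : ℝ)..x, k t) x = k x := by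
    intro w k hw b hb
    have hac : AbsolutelyContinuousOnInterval (fun x => w 0 + ∫ t in (0 : ℝ)..x, k t) 0 b := by
      have hc : AbsolutelyContinuousOnInterval (fun _ : ℝ => w 0) 0 b :=
        ((LipschitzWith.const (w 0)).lipschitzOnWith (s := uIcc 0 b)).absolutelyContinuousOnInterval
      exact hc.add
        ((hw.1 b hb).absolutelyContinuousOnInterval_intervalIntegral (c := 0) (by simp))
    have heq : ∀ x ∈ uIcc 0 b, w x = w 0 + ∫ t in (0 : ℝ)..x, k t := by
      intro x hx
      rw [uIcc_of_le hb] at hx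
      exact hw.2 x hx.1
    refine ⟨hac, heq, hac.continuousOn.congr heq, ?_⟩
    filter_upwards [(hw.1 b hb).ae_hasDerivAt_integral] with x hx hxb
    exact ((hx hxb 0 (by simp)).const_add (w 0)).deriv
  refine ⟨fun b hb => ?_, fun b hb => ?_⟩
  · obtain ⟨-, -, hcu, -⟩ := key hu b hb
    obtain ⟨-, -, hcv, -⟩ := key hv b hb
    exact ((hu.1 b hb).mul_continuousOn hcv).add ((hv.1 b hb).continuousOn_mul hcu)
  · obtain ⟨hau, heu, -, hdu⟩ := key hu b hb
    obtain ⟨hav, hev, -, hdv⟩ := key hv b hb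
    have h1 := hau.integral_deriv_mul_eq_sub hav
    have h2 : ∫ x in (0 : ℝ)..b, (g x * v x + u x * h x) = u b * v b - u 0 * v 0 := by
      rw [heu b right_mem_uIcc, hev b right_mem_uIcc]
      simp only [integral_same, add_zero] at h1
      rw [← h1]
      apply intervalIntegral.integral_congr_ae
      filter_upwards [hdu, hdv] with x hx1 hx2 hx
      have hx' := uIoc_subset_uIcc hx
      rw [hx1 hx', hx2 hx', ← heu x hx', ← hev x hx']
    rw [h2]
    ring

lemma of_hasDerivAt (hd : ∀ x, 0 ≤ x → HasDerivAt u (g x) x) (hg : ContinuousOn g (Ici 0)) :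
    IsPrimitive u g := by
  have hi : ∀ b, 0 ≤ b → IntervalIntegrable g volume 0 b := fun b hb =>
    (hg.mono (by rw [uIcc_of_le hb]; exact Icc_subset_Ici_self)).intervalIntegrable
  refine ⟨hi, fun b hb => ?_⟩
  rw [integral_eq_sub_of_hasDerivAt (fun x hx => hd x ?_) (hi b hb)]
  · ring
  · rw [uIcc_of_le hb] at hx
    exact hx.1

lemma congr_deriv (hu : IsPrimitive u g) (hgh : g =ᵐ[halfLine] h) : IsPrimitive u h := by
  have hm : ∀ b, 0 ≤ b → g =ᵐ[volume.restrict (uIoc 0 b)] h := fun b hb => by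
    rw [uIoc_of_le hb]
    exact ae_restrict_of_ae_restrict_of_subset Ioc_subset_Ioi_self hgh
  refine ⟨fun b hb => (hu.1 b hb).congr_ae (hm b hb), fun b hb => ?_⟩
  rw [hu.2 b hb]
  congr 1
  exact integral_congr_ae_restrict (hm b hb)

lemma continuousOn (hu : IsPrimitive u g) : ContinuousOn u (Ici 0) := by
  have : ∀ b, 0 ≤ b → ContinuousOn u (Icc 0 b) := by
    intro b hb
    have hc := continuousOn_primitive_interval' (hu.1 b hb) (left_mem_uIcc)
    rw [uIcc_of_le hb] at hc
    exact (continuousOn_const.add hc).congr fun x hx => hu.2 x hx.1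
  intro x hx
  have hx0 : (0 : ℝ) ≤ x := hx
  have h1 := this (x + 1) (by linarith) x ⟨hx, by linarith⟩
  refine h1.mono_of_mem_nhdsWithin ?_
  rw [← Ici_inter_Iic]
  exact inter_mem_nhdsWithin _ (Iic_mem_nhds (by linarith))

lemma eq_const (hu : IsPrimitive u g) (hg : g =ᵐ[halfLine] 0) {x : ℝ} (hx : 0 ≤ x) :
    u x = u 0 := by
  rw [(hu.congr_deriv hg).2 x hx]
  simp

lemma tendsto (hu : IsPrimitive u g) (hg : Integrable g halfLine) :
    Tendsto u atTop (𝓝 (u 0 + ∫ x in Ioi (0 : ℝ), g x)) := by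
  have := (intervalIntegral_tendsto_integral_Ioi 0 hg tendsto_id).const_add (u 0)
  refine this.congr' ?_
  filter_upwards [eventually_ge_atTop 0] with x hx
  exact (hu.2 x hx).symm

lemma eq_zero_of_tendsto_of_integrable {l : ℝ} (hl : Tendsto u atTop (𝓝 l))
    (hi : Integrable u halfLine) : l = 0 := by
  by_contra hne
  have hpos : 0 < |l| := abs_pos.2 hne
  have hev : ∀ᶠ x in atTop, |l| / 2 < |u x| :=
    hl.abs.eventually_const_lt (by linarith)
  obtain ⟨R, hR⟩ := eventually_atTop.1 hev
  have hi2 : IntegrableOn u (Ioi (max R 0)) :=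
    IntegrableOn.mono_set hi (Ioi_subset_Ioi (le_max_right _ _))
  have hc : IntegrableOn (fun _ : ℝ => |l| / 2) (Ioi (max R 0)) := by
    refine Integrable.mono hi2 aestronglyMeasurable_const ?_
    filter_upwards [ae_restrict_mem measurableSet_Ioi] with x hx
    rw [Real.norm_of_nonneg (by positivity), Real.norm_eq_abs]
    exact (hR x ((le_max_left _ _).trans (le_of_lt hx))).le
  rw [integrableOn_const_iff] at hc
  rcases hc with hc | hc
  · simp [hpos.ne'] at hc
  · simp at hc

/-- An integrable function that has a limit at infinity has limit zero, so only the boundary term at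
the vertex survives. In the integrations by parts below, `u` is a product of two square integrable
functions or of a locally integrable function and a test function. -/
lemma integral_eq_neg (hu : IsPrimitive u g) (hg : Integrable g halfLine)
    (hi : Integrable u halfLine) : ∫ x in Ioi (0 : ℝ), g x = - u 0 := by
  have := eq_zero_of_tendsto_of_integrable (hu.tendsto hg) hi
  linarith

end IsPrimitive

end

/-! ### Test functions and weak derivatives -/

/-- Smooth functions with compact support in the open half line. -/
structure IsTest (η : ℝ → ℝ) : Prop where
  contDiff : ContDiff ℝ ((⊤ : ℕ∞) : WithTop ℕ∞) η
  hasCompactSupport : HasCompactSupport η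
  tsupport_subset : tsupport η ⊆ Ioi 0

/-- Local integrability on the closed half line. -/
def LocInt (w : ℝ → ℝ) : Prop := ∀ b, 0 ≤ b → IntervalIntegrable w volume 0 b

lemma IsPrimitive.locInt {u g : ℝ → ℝ} (h : IsPrimitive u g) : LocInt u := fun b hb =>
  (h.continuousOn.mono (by rw [uIcc_of_le hb]; exact Icc_subset_Ici_self)).intervalIntegrable

lemma LocInt.of_memLp {w : ℝ → ℝ} (h : MemLp w 2 halfLine) : LocInt w := by
  intro b hb
  rw [intervalIntegrable_iff_integrableOn_Ioc_of_le hb]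
  have h2 : MemLp w 2 (volume.restrict (Ioc 0 b)) :=
    h.mono_measure (Measure.restrict_mono Ioc_subset_Ioi_self le_rfl)
  exact h2.integrable (by norm_num)

lemma LocInt.isPrimitive {w : ℝ → ℝ} (h : LocInt w) :
    IsPrimitive (fun x => ∫ t in (0 : ℝ)..x, w t) w :=
  ⟨h, fun b _ => by simp⟩

lemma isPrimitive_const (c : ℝ) : IsPrimitive (fun _ => c) (fun _ => 0) :=
  IsPrimitive.of_hasDerivAt (fun x _ => hasDerivAt_const x c) continuousOn_const

lemma LocInt.integrable_mul {w η : ℝ → ℝ} (h : LocInt w) (hη : Continuous η)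
    (hs : HasCompactSupport η) : Integrable (fun x => w x * η x) halfLine := by
  obtain ⟨b, hb⟩ := hs.isCompact.bddAbove
  set B := max b 0 with hB
  have hB0 : 0 ≤ B := le_max_right _ _
  have h1 : IntegrableOn (fun x => w x * η x) (Ioc 0 B) := by
    rw [← intervalIntegrable_iff_integrableOn_Ioc_of_le hB0]
    exact (h B hB0).mul_continuousOn hη.continuousOn
  have h2 : IntegrableOn (fun x => w x * η x) (Ioi B) := by
    refine (integrableOn_zero (s := Ioi B)).congr_fun (fun x hx => ?_) measurableSet_Ioi
    have : η x = 0 := by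
      by_contra hne
      have := hb (subset_tsupport η hne)
      exact absurd ((le_max_left b 0).trans_lt hx) (not_lt.2 this)
    simp [this]
  have := h1.union h2
  rwa [Ioc_union_Ioi_eq_Ioi hB0] at this

namespace IsTest

variable {η θ : ℝ → ℝ}

lemma continuous (h : IsTest η) : Continuous η := h.contDiff.continuous

lemma deriv (h : IsTest η) : IsTest (deriv η) :=
  ⟨(contDiff_infty_iff_deriv.1 h.contDiff).2, h.hasCompactSupport.deriv,
    (tsupport_deriv_subset).trans h.tsupport_subset⟩

lemma sub_const_mul (h : IsTest η) (k : IsTest θ) (c : ℝ) : IsTest (fun x => η x - c * θ x) := by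
  have e : (fun x => η x - c * θ x) = η - (fun _ => c) * θ := rfl
  have hk : HasCompactSupport ((fun _ : ℝ => c) * θ) := k.hasCompactSupport.mul_left
  refine ⟨h.contDiff.sub (contDiff_const.mul k.contDiff), ?_, ?_⟩
  · rw [e]; exact h.hasCompactSupport.sub hk
  · rw [e]
    exact (tsupport_sub _ _).trans (union_subset h.tsupport_subset
      ((tsupport_mul_subset_right).trans k.tsupport_subset))

lemma eq_zero_of_nonpos (h : IsTest η) {x : ℝ} (hx : x ≤ 0) : η x = 0 := by
  by_contra hne
  exact absurd (h.tsupport_subset (subset_tsupport η hne)) (not_lt.2 hx)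

lemma hasDerivAt (h : IsTest η) (x : ℝ) : HasDerivAt η (_root_.deriv η x) x :=
  (h.contDiff.differentiable (by simp) x).hasDerivAt

lemma isPrimitive (h : IsTest η) : IsPrimitive η (_root_.deriv η) :=
  IsPrimitive.of_hasDerivAt (fun x _ => h.hasDerivAt x) h.deriv.continuous.continuousOn

lemma integrable (h : IsTest η) : Integrable η halfLine :=
  (h.continuous.integrable_of_hasCompactSupport h.hasCompactSupport).restrict

lemma memLp (h : IsTest η) : MemLp η 2 halfLine :=
  h.continuous.memLp_of_hasCompactSupport h.hasCompactSupport

/-- The primitive starting at `0` vanishes to the left of the support, and vanishing mean makes it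
vanish again to the right. -/
lemma exists_primitive (h : IsTest η) (h0 : ∫ x in Ioi (0 : ℝ), η x = 0) :
    ∃ ζ, IsTest ζ ∧ _root_.deriv ζ = η := by
  obtain ⟨a, b, ha, hab⟩ : ∃ a b, 0 < a ∧ tsupport η ⊆ Icc a b := by
    by_cases hne : (tsupport η).Nonempty
    · obtain ⟨a, ha⟩ := h.hasCompactSupport.isCompact.exists_isLeast hne
      obtain ⟨b, hb⟩ := h.hasCompactSupport.isCompact.bddAbove
      exact ⟨a, b, h.tsupport_subset ha.1, fun x hx => ⟨ha.2 hx, hb hx⟩⟩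
    · rw [not_nonempty_iff_eq_empty] at hne
      exact ⟨1, 1, one_pos, by simp [hne]⟩
  have hz : ∀ x, x ∉ Icc a b → η x = 0 := fun x hx => by
    by_contra hne
    exact hx (hab (subset_tsupport η hne))
  set ζ : ℝ → ℝ := fun x => ∫ t in (0 : ℝ)..x, η t with hζ
  have hd : ∀ x, HasDerivAt ζ (η x) x := fun x =>
    intervalIntegral.integral_hasDerivAt_right (h.continuous.intervalIntegrable _ _)
      (h.continuous.stronglyMeasurableAtFilter _ _) h.continuous.continuousAt
  have hde : _root_.deriv ζ = η := funext fun x => (hd x).deriv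
  have hsupp : Function.support ζ ⊆ Icc a b := by
    intro x hx
    by_contra hxab
    apply hx
    rcases lt_or_ge x a with hxa | hxa
    · apply intervalIntegral.integral_zero_ae
      filter_upwards with t ht
      refine hz t fun hta => ?_
      have := uIoc_subset_uIcc ht
      rw [mem_uIcc] at this
      rcases this with h' | h' <;> linarith [hta.1, h'.2]
    · have hxb : b < x := by
        by_contra hxb
        exact hxab ⟨hxa, not_lt.1 hxb⟩
      have hx0 : 0 ≤ x := by linarith
      have e := intervalIntegral.integral_interval_add_Ioi h.integrable
        (IntegrableOn.mono_set h.integrable (Ioi_subset_Ioi hx0))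
      rw [h0, setIntegral_eq_zero_of_forall_eq_zero (t := Ioi x)] at e
      · simpa using e
      · intro t ht
        exact hz t fun hta => absurd hta.2 (not_le.2 (hxb.trans ht))
  have hts : tsupport ζ ⊆ Icc a b := closure_minimal hsupp isClosed_Icc
  refine ⟨ζ, ⟨?_, HasCompactSupport.of_support_subset_isCompact isCompact_Icc hsupp,
    hts.trans fun x hx => ha.trans_le hx.1⟩, hde⟩
  rw [contDiff_infty_iff_deriv]
  exact ⟨fun x => (hd x).differentiableAt, hde ▸ h.contDiff⟩

end IsTest

lemma exists_isTest_integral_eq_one : ∃ θ, IsTest θ ∧ ∫ x in Ioi (0 : ℝ), θ x = 1 := by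
  let φ : ContDiffBump (2 : ℝ) := ⟨1 / 2, 1, by norm_num, by norm_num⟩
  have ht : tsupport (φ.normed volume) ⊆ Ioi 0 := by
    rw [φ.tsupport_normed_eq, Real.closedBall_eq_Icc]
    intro x hx
    have := hx.1
    simp only [φ] at this
    simp only [mem_Ioi]
    linarith
  refine ⟨φ.normed volume, ⟨φ.contDiff_normed, φ.hasCompactSupport_normed, ht⟩, ?_⟩
  rw [setIntegral_eq_integral_of_forall_compl_eq_zero, φ.integral_normed]
  intro x hx
  by_contra hne
  exact hx (ht (subset_tsupport _ hne))

lemma ae_eq_of_forall_isTest {w w' : ℝ → ℝ} (hw : LocInt w) (hw' : LocInt w')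
    (h : ∀ η, IsTest η → ∫ x in Ioi (0 : ℝ), w x * η x = ∫ x in Ioi (0 : ℝ), w' x * η x) :
    w =ᵐ[halfLine] w' := by
  have hloc : LocallyIntegrableOn (fun x => w x - w' x) (Ioi (0 : ℝ)) := by
    have hi : LocInt (fun x => w x - w' x) := fun b hb => (hw b hb).sub (hw' b hb)
    rw [locallyIntegrableOn_iff isOpen_Ioi.isLocallyClosed]
    intro k hk hkc
    obtain ⟨b, hb⟩ := hkc.bddAbove
    refine ((intervalIntegrable_iff_integrableOn_Ioc_of_le (le_max_right b 0)).1
      (hi _ (le_max_right b 0))).mono_set fun x hx => ⟨hk hx, (hb hx).trans (le_max_left _ _)⟩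
  have key := isOpen_Ioi.ae_eq_zero_of_integral_contDiff_smul_eq_zero hloc (fun η h1 h2 h3 => by
    have e : (∫ x, η x • (w x - w' x)) = ∫ x in Ioi (0 : ℝ), η x • (w x - w' x) := by
      symm
      apply setIntegral_eq_integral_of_forall_compl_eq_zero
      intro x hx
      have : η x = 0 := by
        by_contra hne
        exact hx (h3 (subset_tsupport η hne))
      simp [this]
    have e2 : ∫ x in Ioi (0 : ℝ), η x • (w x - w' x)
        = (∫ x in Ioi (0 : ℝ), w x * η x) - ∫ x in Ioi (0 : ℝ), w' x * η x := by
      rw [← integral_sub (hw.integrable_mul h1.continuous h2)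
        (hw'.integrable_mul h1.continuous h2)]
      apply integral_congr_ae
      filter_upwards with x
      simp only [smul_eq_mul]
      ring
    rw [e, e2, h η ⟨h1, h2, h3⟩, sub_self])
  have := (ae_restrict_iff' (μ := volume) (measurableSet_Ioi (a := (0 : ℝ)))
    (p := fun x => w x - w' x = 0)).2 key
  filter_upwards [this] with x hx
  linarith

lemma IsPrimitive.integral_mul_deriv {u v η : ℝ → ℝ} (h : IsPrimitive u v) (hη : IsTest η) :
    ∫ x in Ioi (0 : ℝ), u x * deriv η x = - ∫ x in Ioi (0 : ℝ), v x * η x := by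
  have i1 : Integrable (fun x => v x * η x) halfLine :=
    LocInt.integrable_mul h.1 hη.continuous hη.hasCompactSupport
  have i2 := h.locInt.integrable_mul hη.deriv.continuous hη.deriv.hasCompactSupport
  have i3 := h.locInt.integrable_mul hη.continuous hη.hasCompactSupport
  have := (h.mul hη.isPrimitive).integral_eq_neg (i1.add i2) i3
  rw [integral_add i1 i2, hη.eq_zero_of_nonpos le_rfl] at this
  linarith

/-- The du Bois-Reymond lemma on the half line. -/
lemma exists_ae_eq_const {w : ℝ → ℝ} (hw : LocInt w)
    (h : ∀ η, IsTest η → ∫ x in Ioi (0 : ℝ), w x * deriv η x = 0) :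
    ∃ c : ℝ, w =ᵐ[halfLine] fun _ => c := by
  obtain ⟨θ, hθ, h1⟩ := exists_isTest_integral_eq_one
  refine ⟨∫ x in Ioi (0 : ℝ), w x * θ x,
    ae_eq_of_forall_isTest hw (isPrimitive_const _).locInt fun η hη => ?_⟩
  -- Subtracting a multiple of the normalised bump `θ` produces mean zero, hence an admissible
  -- derivative; this forces the constant to be `∫ w θ`.
  obtain ⟨ζ, hζ, hζd⟩ := (hη.sub_const_mul hθ (∫ x in Ioi (0 : ℝ), η x)).exists_primitive (by
    rw [integral_sub hη.integrable (hθ.integrable.const_mul _), integral_const_mul, h1]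
    ring)
  have := h ζ hζ
  rw [hζd] at this
  have i1 := hw.integrable_mul hη.continuous hη.hasCompactSupport
  have i2 := hw.integrable_mul hθ.continuous hθ.hasCompactSupport
  have e : ∫ x in Ioi (0 : ℝ), w x * (η x - (∫ x in Ioi (0 : ℝ), η x) * θ x)
      = (∫ x in Ioi (0 : ℝ), w x * η x)
        - (∫ x in Ioi (0 : ℝ), η x) * ∫ x in Ioi (0 : ℝ), w x * θ x := by
    rw [← integral_const_mul, ← integral_sub i1 (i2.const_mul _)]
    congr 1
    ext x
    ring
  rw [e] at this
  rw [integral_const_mul]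
  linarith

lemma exists_isPrimitive {f g : ℝ → ℝ} (hf : LocInt f) (hg : LocInt g)
    (h : ∀ η, IsTest η → ∫ x in Ioi (0 : ℝ), f x * deriv η x = - ∫ x in Ioi (0 : ℝ), g x * η x) :
    ∃ u, f =ᵐ[halfLine] u ∧ IsPrimitive u g := by
  have hG := hg.isPrimitive
  obtain ⟨c, hc⟩ := exists_ae_eq_const (w := fun x => f x - ∫ t in (0 : ℝ)..x, g t)
    (fun b hb => (hf b hb).sub (hG.locInt b hb)) (fun η hη => by
      have i1 := hf.integrable_mul hη.deriv.continuous hη.deriv.hasCompactSupport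
      have i2 := hG.locInt.integrable_mul hη.deriv.continuous hη.deriv.hasCompactSupport
      simp only [sub_mul]
      rw [integral_sub i1 i2, h η hη, hG.integral_mul_deriv hη]
      ring)
  refine ⟨fun x => c + ∫ t in (0 : ℝ)..x, g t, ?_, ?_⟩
  · filter_upwards [hc] with x hx
    linarith
  · simpa using (isPrimitive_const c).add hG

/-- Needed for the adjoint, where only the second weak derivative is known. The first derivative
must be an antiderivative of `z`, and the free constant is fixed by testing against one bump `θ`. -/
lemma exists_isPrimitive_of_second {y z : ℝ → ℝ} (hy : LocInt y) (hz : LocInt z)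
    (h : ∀ η, IsTest η →
      ∫ x in Ioi (0 : ℝ), y x * deriv (deriv η) x = ∫ x in Ioi (0 : ℝ), z x * η x) :
    ∃ u v, y =ᵐ[halfLine] u ∧ IsPrimitive u v ∧ IsPrimitive v z := by
  obtain ⟨θ, hθ, h1⟩ := exists_isTest_integral_eq_one
  have hZ := hz.isPrimitive
  set Z : ℝ → ℝ := fun x => ∫ t in (0 : ℝ)..x, z t with hZdef
  -- Since `∫ θ = 1`, this is the only value for which `∫ y θ' = -∫ (Z - C) θ`.
  set C : ℝ := (∫ x in Ioi (0 : ℝ), y x * deriv θ x) + ∫ x in Ioi (0 : ℝ), Z x * θ x with hC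
  have hv : IsPrimitive (fun x => Z x - C) z := by
    simpa using hZ.sub (isPrimitive_const C)
  obtain ⟨u, hu, hu'⟩ := exists_isPrimitive hy hv.locInt (fun η hη => by
    obtain ⟨ζ, hζ, hζd⟩ := (hη.sub_const_mul hθ (∫ x in Ioi (0 : ℝ), η x)).exists_primitive (by
      rw [integral_sub hη.integrable (hθ.integrable.const_mul _), integral_const_mul, h1]
      ring)
    have e := h ζ hζ
    have e' := hZ.integral_mul_deriv hζ
    set m := ∫ x in Ioi (0 : ℝ), η x with hm
    have hdd : deriv (deriv ζ) = fun x => deriv η x - m * deriv θ x := by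
      rw [hζd]
      ext x
      exact ((hη.hasDerivAt x).sub ((hθ.hasDerivAt x).const_mul m)).deriv
    rw [hdd] at e
    rw [hζd] at e'
    have i1 := hy.integrable_mul hη.deriv.continuous hη.deriv.hasCompactSupport
    have i2 := hy.integrable_mul hθ.deriv.continuous hθ.deriv.hasCompactSupport
    have i3 := hZ.locInt.integrable_mul hη.continuous hη.hasCompactSupport
    have i4 := hZ.locInt.integrable_mul hθ.continuous hθ.hasCompactSupport
    have e1 : ∫ x in Ioi (0 : ℝ), y x * (deriv η x - m * deriv θ x)
        = (∫ x in Ioi (0 : ℝ), y x * deriv η x) - m * ∫ x in Ioi (0 : ℝ), y x * deriv θ x := by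
      rw [← integral_const_mul, ← integral_sub i1 (i2.const_mul _)]
      congr 1
      ext x
      ring
    have e2 : ∫ x in Ioi (0 : ℝ), Z x * (η x - m * θ x)
        = (∫ x in Ioi (0 : ℝ), Z x * η x) - m * ∫ x in Ioi (0 : ℝ), Z x * θ x := by
      rw [← integral_const_mul, ← integral_sub i3 (i4.const_mul _)]
      congr 1
      ext x
      ring
    have e3 : ∫ x in Ioi (0 : ℝ), (Z x - C) * η x
        = (∫ x in Ioi (0 : ℝ), Z x * η x) - C * m := by
      rw [hm, ← integral_const_mul, ← integral_sub i3 (hη.integrable.const_mul _)]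
      congr 1
      ext x
      ring
    rw [e1] at e
    rw [e2] at e'
    rw [e3, hC]
    linarith)
  exact ⟨u, _, hu, hu', hv⟩

/-- If `u` and `u''` are square integrable on the half line, then so is `u'`. -/
lemma IsPrimitive.memLp_deriv {u v z : ℝ → ℝ} (hu : IsPrimitive u v) (hv : IsPrimitive v z)
    (u2 : MemLp u 2 halfLine) (z2 : MemLp z 2 halfLine) : MemLp v 2 halfLine := by
  have hvm : AEStronglyMeasurable v halfLine :=
    (hv.continuousOn.mono Ioi_subset_Ici_self).aestronglyMeasurable measurableSet_Ioi
  rw [memLp_two_iff_integrable_sq hvm]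
  have huz : Integrable (fun x => u x * z x) halfLine := u2.integrable_mul z2
  have huv := hu.mul hv
  have hloc : LocInt (fun x => v x ^ 2) := by
    have := (hv.mul hv).locInt
    simpa only [sq] using this
  set F : ℝ → ℝ := fun x => ∫ t in (0 : ℝ)..x, v t ^ 2 with hF
  set K := ∫ x in Ioi (0 : ℝ), ‖u x * z x‖ with hK
  -- Integrate `(u v)' = v² + u z`, where `u z` is integrable with `L¹` norm `K`.
  have hlow : ∀ x, 0 ≤ x → u 0 * v 0 + F x - K ≤ u x * v x := by
    intro x hx
    have e := huv.2 x hx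
    have i1 := hloc x hx
    have i2 : IntervalIntegrable (fun t => u t * z t) volume 0 x := by
      rw [intervalIntegrable_iff_integrableOn_Ioc_of_le hx]
      exact IntegrableOn.mono_set huz Ioc_subset_Ioi_self
    have e2 : ∫ t in (0 : ℝ)..x, (v t * v t + u t * z t)
        = F x + ∫ t in (0 : ℝ)..x, u t * z t := by
      rw [hF, ← intervalIntegral.integral_add i1 i2]
      simp only [sq]
    have e3 : -K ≤ ∫ t in (0 : ℝ)..x, u t * z t := by
      have h1 : |∫ t in (0 : ℝ)..x, u t * z t| ≤ ∫ t in (0 : ℝ)..x, ‖u t * z t‖ := by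
        rw [← Real.norm_eq_abs]
        exact intervalIntegral.norm_integral_le_integral_norm hx
      have h2 : ∫ t in (0 : ℝ)..x, ‖u t * z t‖ ≤ K := by
        rw [intervalIntegral.integral_of_le hx]
        exact setIntegral_mono_set huz.norm (Eventually.of_forall fun _ => norm_nonneg _)
          Ioc_subset_Ioi_self.eventuallyLE
      linarith [neg_abs_le (∫ t in (0 : ℝ)..x, u t * z t)]
    rw [e, e2]
    linarith
  have hmono : ∀ x y, 0 ≤ x → x ≤ y → F x ≤ F y := by
    intro x y hx hxy
    exact intervalIntegral.integral_mono_interval le_rfl hx hxy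
      (Eventually.of_forall fun _ => sq_nonneg _) (hloc y (hx.trans hxy))
  by_cases hb : ∃ M, ∀ x, 0 ≤ x → F x ≤ M
  · obtain ⟨M, hM⟩ := hb
    refine integrableOn_Ioi_of_intervalIntegral_norm_bounded M 0 (l := atTop) (b := id)
      (fun i => ?_) tendsto_id ?_
    · rcases le_total 0 i with hi | hi
      · exact (intervalIntegrable_iff_integrableOn_Ioc_of_le hi).1 (hloc i hi)
      · simp [Ioc_eq_empty (not_lt.2 hi)]
    · filter_upwards [eventually_ge_atTop 0] with x hx
      have := hM x hx
      simpa [hF] using this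
  -- If `∫ v²` diverges, then eventually `u v ≥ 1`, so `(u²)' = 2 u v` makes `u²` grow at least
  -- linearly, contradicting the square integrability of `u`.
  · exfalso
    push Not at hb
    obtain ⟨R, hR0, hR⟩ := hb (K - u 0 * v 0 + 1)
    have h1 : ∀ x, R ≤ x → 1 ≤ u x * v x := fun x hx => by
      linarith [hlow x (hR0.trans hx), hmono R x hR0 hx]
    have huu := hu.mul hu
    have h2 : ∀ x, R ≤ x → x - R ≤ u x * u x := fun x hx => by
      have hx0 := hR0.trans hx
      have e1 := huu.2 x hx0
      have e2 := huu.2 R hR0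
      have e3 : u x * u x - u R * u R = ∫ t in R..x, (v t * u t + u t * v t) := by
        rw [← intervalIntegral.integral_interval_sub_left (huu.1 x hx0) (huu.1 R hR0)]
        linarith
      have e4 : ∫ t in R..x, (1 : ℝ) ≤ ∫ t in R..x, (v t * u t + u t * v t) := by
        refine intervalIntegral.integral_mono_on hx intervalIntegrable_const
          ((huu.1 R hR0).symm.trans (huu.1 x hx0)) fun t ht => ?_
        linarith [h1 t ht.1, mul_comm (u t) (v t)]
      simp only [intervalIntegral.integral_const, smul_eq_mul, mul_one] at e4
      nlinarith [mul_self_nonneg (u R)]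
    have hi : IntegrableOn (fun x => u x ^ 2) (Ioi (R + 1)) :=
      IntegrableOn.mono_set u2.integrable_sq (Ioi_subset_Ioi (by linarith))
    have hc : IntegrableOn (fun _ : ℝ => (1 : ℝ)) (Ioi (R + 1)) := by
      refine Integrable.mono hi aestronglyMeasurable_const ?_
      filter_upwards [ae_restrict_mem measurableSet_Ioi] with x hx
      have hx' : R + 1 < x := hx
      rw [Real.norm_of_nonneg zero_le_one, Real.norm_of_nonneg (sq_nonneg _)]
      linarith [h2 x (by linarith), sq (u x)]
    rw [integrableOn_const_iff] at hc
    simp at hc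

/-! ### Continuous representatives, Green's formula and vertex data -/

lemma HasWeakDeriv.exists_isPrimitive {f g : EdgeL2} (h : HasWeakDeriv f g) :
    ∃ u, f =ᵐ[halfLine] u ∧ IsPrimitive u g :=
  StarGraph.exists_isPrimitive (LocInt.of_memLp (Lp.memLp f)) (LocInt.of_memLp (Lp.memLp g))
    fun η hη => h η hη.1 hη.2 hη.3

lemma IsPrimitive.hasWeakDeriv {f g : EdgeL2} {u v : ℝ → ℝ} (h : IsPrimitive u v)
    (hf : f =ᵐ[halfLine] u) (hg : g =ᵐ[halfLine] v) : HasWeakDeriv f g := by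
  intro η h1 h2 h3
  have e1 : ∫ x in Ioi (0 : ℝ), f x * deriv η x = ∫ x in Ioi (0 : ℝ), u x * deriv η x := by
    apply integral_congr_ae
    filter_upwards [hf] with x hx
    rw [hx]
  have e2 : ∫ x in Ioi (0 : ℝ), g x * η x = ∫ x in Ioi (0 : ℝ), v x * η x := by
    apply integral_congr_ae
    filter_upwards [hg] with x hx
    rw [hx]
  rw [e1, e2, h.integral_mul_deriv ⟨h1, h2, h3⟩]

lemma IsPrimitive.hasVertexValue {f : EdgeL2} {u v : ℝ → ℝ} (h : IsPrimitive u v)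
    (hf : f =ᵐ[halfLine] u) : HasVertexValue f (u 0) :=
  ⟨u, h.continuousOn, hf, rfl⟩

lemma eqOn_Ici_of_ae_eq {u v : ℝ → ℝ} (hu : ContinuousOn u (Ici 0)) (hv : ContinuousOn v (Ici 0))
    (h : u =ᵐ[halfLine] v) : EqOn u v (Ici 0) := by
  have h1 : EqOn u v (Ioi 0) := Measure.eqOn_open_of_ae_eq h isOpen_Ioi
    (hu.mono Ioi_subset_Ici_self) (hv.mono Ioi_subset_Ici_self)
  exact h1.of_subset_closure hu hv Ioi_subset_Ici_self (by rw [closure_Ioi])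

lemma HasVertexValue.eq_of_ae_eq {f : EdgeL2} {c : ℝ} {u : ℝ → ℝ} (h : HasVertexValue f c)
    (hf : f =ᵐ[halfLine] u) (hu : ContinuousOn u (Ici 0)) : u 0 = c := by
  obtain ⟨w, hw, hfw, rfl⟩ := h
  exact eqOn_Ici_of_ae_eq hu hw (hf.symm.trans hfw) self_mem_Ici

/-- `u` represents `f`, `v` represents `f'`, both continuous on `[0, ∞)`, and `v' = f''`. -/
structure IsRepr (f f' f'' : EdgeL2) (u v : ℝ → ℝ) : Prop where
  ae_eq : f =ᵐ[halfLine] u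
  ae_eq_deriv : f' =ᵐ[halfLine] v
  prim : IsPrimitive u v
  prim_deriv : IsPrimitive v f''

namespace IsRepr

variable {f f' f'' g g' g'' : EdgeL2} {u v p q : ℝ → ℝ}

lemma memLp (h : IsRepr f f' f'' u v) : MemLp u 2 halfLine :=
  (memLp_congr_ae h.ae_eq).1 (Lp.memLp f)

lemma memLp_deriv (h : IsRepr f f' f'' u v) : MemLp v 2 halfLine :=
  (memLp_congr_ae h.ae_eq_deriv).1 (Lp.memLp f')

/-- The Wronskian `v p - u q` has derivative `f'' g - f g''`, and it is integrable, so it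
contributes only at the vertex. -/
lemma integral_green (h : IsRepr f f' f'' u v) (k : IsRepr g g' g'' p q) :
    (∫ x in Ioi (0 : ℝ), f'' x * g x) - ∫ x in Ioi (0 : ℝ), f x * g'' x
      = u 0 * q 0 - v 0 * p 0 := by
  have hp := (h.prim_deriv.mul k.prim).sub (h.prim.mul k.prim_deriv)
  have i1 : Integrable (fun x => f'' x * g x) halfLine := (Lp.memLp f'').integrable_mul (Lp.memLp g)
  have i2 : Integrable (fun x => f x * g'' x) halfLine := (Lp.memLp f).integrable_mul (Lp.memLp g'')
  have hp' : IsPrimitive (fun x => v x * p x - u x * q x)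
      (fun x => f'' x * g x - f x * g'' x) := by
    refine hp.congr_deriv ?_
    filter_upwards [h.ae_eq, k.ae_eq] with x h1 h2
    rw [h1, h2]
    ring
  have i3 : Integrable (fun x => v x * p x - u x * q x) halfLine :=
    (h.memLp_deriv.integrable_mul k.memLp).sub (h.memLp.integrable_mul k.memLp_deriv)
  have := hp'.integral_eq_neg (i1.sub i2) i3
  rw [integral_sub i1 i2] at this
  linarith

lemma hasWeakDeriv (h : IsRepr f f' f'' u v) : HasWeakDeriv f f' :=
  h.prim.hasWeakDeriv h.ae_eq h.ae_eq_deriv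

lemma hasWeakDeriv_deriv (h : IsRepr f f' f'' u v) : HasWeakDeriv f' f'' :=
  h.prim_deriv.hasWeakDeriv h.ae_eq_deriv (ae_eq_refl _)

end IsRepr

lemma HasWeakDeriv.exists_isRepr {f f' f'' : EdgeL2} (h : HasWeakDeriv f f')
    (h' : HasWeakDeriv f' f'') : ∃ u v, IsRepr f f' f'' u v := by
  obtain ⟨u, hu, hu'⟩ := h.exists_isPrimitive
  obtain ⟨v, hv, hv'⟩ := h'.exists_isPrimitive
  exact ⟨u, v, hu, hv, hu'.congr_deriv hv, hv'⟩

lemma IsDeltaData.exists_isRepr {N : ℕ} {α : ℝ} {Ψ Ψ' Ψ'' : GraphL2 N}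
    (h : IsDeltaData α Ψ Ψ' Ψ'') : ∃ (u v : Fin N → ℝ → ℝ) (c : ℝ),
      (∀ i, IsRepr (Ψ i) (Ψ' i) (Ψ'' i) (u i) (v i)) ∧ (∀ i, u i 0 = c) ∧
      ∑ i, v i 0 = α * c := by
  obtain ⟨h1, h2, c, d, h3, h4, h5⟩ := h
  choose u v huv using fun i => (h1 i).exists_isRepr (h2 i)
  refine ⟨u, v, c, huv, fun i => (h3 i).eq_of_ae_eq (huv i).ae_eq (huv i).prim.continuousOn, ?_⟩
  rw [← h5]
  exact Finset.sum_congr rfl fun i _ =>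
    (h4 i).eq_of_ae_eq (huv i).ae_eq_deriv (huv i).prim_deriv.continuousOn

lemma isDeltaData_of_isRepr {N : ℕ} {α : ℝ} {Ψ Ψ' Ψ'' : GraphL2 N} {u v : Fin N → ℝ → ℝ} {c : ℝ}
    (h : ∀ i, IsRepr (Ψ i) (Ψ' i) (Ψ'' i) (u i) (v i)) (hu : ∀ i, u i 0 = c)
    (hv : ∑ i, v i 0 = α * c) : IsDeltaData α Ψ Ψ' Ψ'' :=
  ⟨fun i => (h i).hasWeakDeriv, fun i => (h i).hasWeakDeriv_deriv, c, fun i => v i 0,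
    fun i => hu i ▸ (h i).prim.hasVertexValue (h i).ae_eq,
    fun i => (h i).prim_deriv.hasVertexValue (h i).ae_eq_deriv, hv⟩

/-- Symmetry of the second derivative on `𝒟(H)`. -/
lemma IsDeltaData.green {N : ℕ} {α : ℝ} {Ψ Ψ' Ψ'' Φ Φ' Φ'' : GraphL2 N}
    (h : IsDeltaData α Ψ Ψ' Ψ'') (k : IsDeltaData α Φ Φ' Φ'') :
    inner ℝ Ψ'' Φ = inner ℝ Ψ Φ'' := by
  obtain ⟨u, v, c, huv, hc, hv⟩ := h.exists_isRepr
  obtain ⟨p, q, e, hpq, he, hq⟩ := k.exists_isRepr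
  have key : ∑ i, (inner ℝ (Ψ'' i) (Φ i) - inner ℝ (Ψ i) (Φ'' i)) = 0 := by
    have : ∀ i, inner ℝ (Ψ'' i) (Φ i) - inner ℝ (Ψ i) (Φ'' i) = c * q i 0 - v i 0 * e := by
      intro i
      have := (huv i).integral_green (hpq i)
      rw [L2.inner_def, L2.inner_def]
      simp only [RCLike.inner_apply, conj_trivial]
      rw [hc, he] at this
      rw [← this]
      simp only [mul_comm]
    rw [Finset.sum_congr rfl fun i _ => this i, Finset.sum_sub_distrib, ← Finset.mul_sum,
      ← Finset.sum_mul, hv, hq]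
    ring
  rw [Finset.sum_sub_distrib, sub_eq_zero] at key
  rw [PiLp.inner_apply, PiLp.inner_apply]
  exact key

/-- The function `x ↦ e^{-cx}` is square integrable on the half line. -/
lemma memLp_exp {c : ℝ} (hc : 0 < c) : MemLp (fun x => Real.exp (-c * x)) 2 halfLine := by
  have hm : AEStronglyMeasurable (fun x => Real.exp (-c * x)) halfLine :=
    (by fun_prop : Continuous fun x => Real.exp (-c * x)).aestronglyMeasurable
  rw [memLp_two_iff_integrable_sq hm]
  refine (exp_neg_integrableOn_Ioi 0 (b := 2 * c) (by positivity)).congr ?_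
  filter_upwards with x
  rw [← Real.exp_nat_mul]
  congr 1
  push_cast
  ring

lemma IsRepr.of_hasDerivAt {u v w : ℝ → ℝ} (hu : MemLp u 2 halfLine) (hv : MemLp v 2 halfLine)
    (hw : MemLp w 2 halfLine) (h1 : ∀ x, 0 ≤ x → HasDerivAt u (v x) x)
    (h2 : ∀ x, 0 ≤ x → HasDerivAt v (w x) x) (hc : ContinuousOn w (Ici 0)) :
    IsRepr (hu.toLp u) (hv.toLp v) (hw.toLp w) u v :=
  ⟨hu.coeFn_toLp, hv.coeFn_toLp,
    IsPrimitive.of_hasDerivAt h1 fun x hx => (h2 x hx).continuousAt.continuousWithinAt,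
    (IsPrimitive.of_hasDerivAt h2 hc).congr_deriv hw.coeFn_toLp.symm⟩

lemma IsTest.isRepr {η : ℝ → ℝ} (h : IsTest η) :
    IsRepr (h.memLp.toLp η) (h.deriv.memLp.toLp _) (h.deriv.deriv.memLp.toLp _) η (_root_.deriv η) :=
  IsRepr.of_hasDerivAt _ _ _ (fun x _ => h.hasDerivAt x) (fun x _ => h.deriv.hasDerivAt x)
    h.deriv.deriv.continuous.continuousOn

/-- There are `H²` functions with prescribed vertex value and derivative. -/
lemma exists_isRepr_vertex (a b : ℝ) : ∃ (f f' f'' : EdgeL2) (u v : ℝ → ℝ),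
    IsRepr f f' f'' u v ∧ u 0 = a ∧ v 0 = b := by
  have e1 := memLp_exp one_pos
  have e2 := memLp_exp two_pos
  -- For `p e^{-x} + q e^{-2x}` the conditions are `p + q = a` and `-p - 2q = b`.
  set p := 2 * a + b
  set q := -(a + b)
  have hd : ∀ (r s : ℝ) (x : ℝ), HasDerivAt
      (fun x => r * Real.exp (-1 * x) + s * Real.exp (-2 * x))
      ((-r) * Real.exp (-1 * x) + (-2 * s) * Real.exp (-2 * x)) x := by
    intro r s x
    have h1 : HasDerivAt (fun x : ℝ => Real.exp (-1 * x)) _ x :=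
      ((hasDerivAt_id x).const_mul (-1)).exp
    have h2 : HasDerivAt (fun x : ℝ => Real.exp (-2 * x)) _ x :=
      ((hasDerivAt_id x).const_mul (-2)).exp
    refine ((h1.const_mul r).add (h2.const_mul s)).congr_deriv ?_
    simp only [id]
    ring
  have hm : ∀ r s : ℝ, MemLp (fun x => r * Real.exp (-1 * x) + s * Real.exp (-2 * x)) 2 halfLine :=
    fun r s => (e1.const_mul r).add (e2.const_mul s)
  refine ⟨_, _, _, _, _, IsRepr.of_hasDerivAt (hm p q) (hm _ _) (hm _ _) (fun x _ => hd p q x)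
    (fun x _ => hd _ _ x) (by fun_prop), ?_, ?_⟩
  · simp [p, q]; ring
  · simp [p, q]; ring

/-! ### Abstract self-adjoint operators: resolvent and negative eigenvalues -/

section Spectral

variable {E : Type*} [NormedAddCommGroup E] [NormedSpace ℝ E] {T : E →ₗ.[ℝ] E}

lemma mem_eigenspace_iff {t : ℝ} {x : E} :
    x ∈ eigenspace T t ↔ ∃ h : x ∈ T.domain, T ⟨x, h⟩ = t • x := by
  constructor
  · rintro ⟨y, hy, rfl⟩
    exact ⟨y.2, sub_eq_zero.1 (LinearMap.mem_ker.1 hy)⟩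
  · rintro ⟨h, hx⟩
    exact ⟨⟨x, h⟩, LinearMap.mem_ker.2 (sub_eq_zero.2 hx), rfl⟩

lemma mem_opKernel_iff {x : E} : x ∈ opKernel T ↔ ∃ h : x ∈ T.domain, T ⟨x, h⟩ = 0 := by
  constructor
  · rintro ⟨y, hy, rfl⟩
    exact ⟨y.2, LinearMap.mem_ker.1 hy⟩
  · rintro ⟨h, hx⟩
    exact ⟨⟨x, h⟩, LinearMap.mem_ker.2 hx, rfl⟩

end Spectral

section Operators

variable {E : Type*} [NormedAddCommGroup E] [InnerProductSpace ℝ E] [CompleteSpace E]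
  {T : E →ₗ.[ℝ] E}

lemma isSelfAdjoint_of_symmetric (hd : Dense (T.domain : Set E))
    (hs : ∀ x y : T.domain, inner ℝ (T x) (y : E) = inner ℝ (x : E) (T y))
    (hm : ∀ y z : E, (∀ x : T.domain, inner ℝ (T x) y = inner ℝ (x : E) z) → y ∈ T.domain) :
    IsSelfAdjoint T := by
  have hle : T ≤ T.adjoint := LinearPMap.IsFormalAdjoint.le_adjoint hd hs
  rw [LinearPMap.isSelfAdjoint_def]
  refine (LinearPMap.eq_of_le_of_domain_eq hle (le_antisymm hle.1 fun y hy => ?_)).symm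
  exact hm y (T.adjoint ⟨y, hy⟩) fun x =>
    (LinearPMap.adjoint_isFormalAdjoint hd).symm x ⟨y, hy⟩

lemma inner_map_symm (hT : IsSelfAdjoint T) (x y : T.domain) :
    inner ℝ (T x) (y : E) = inner ℝ (x : E) (T y) := by
  have h := LinearPMap.adjoint_isFormalAdjoint hT.dense_domain
  rw [LinearPMap.isSelfAdjoint_def.1 hT] at h
  exact h x y

/-- The weak formulation of `T y = z`. It places limits of sequences in the domain without any
control of the images under `T`. -/
lemma exists_map_eq_of_inner (hT : IsSelfAdjoint T) {y z : E}
    (h : ∀ x : T.domain, inner ℝ (T x) y = inner ℝ (x : E) z) :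
    ∃ hy : y ∈ T.domain, T ⟨y, hy⟩ = z := by
  have hy : y ∈ T.domain := by
    have := LinearPMap.mem_adjoint_domain_of_exists (T := T) y
      ⟨z, fun x => by rw [real_inner_comm, ← h x, real_inner_comm]⟩
    rwa [LinearPMap.isSelfAdjoint_def.1 hT] at this
  refine ⟨hy, hT.dense_domain.eq_of_inner_right ℝ fun v hv => ?_⟩
  rw [← inner_map_symm hT ⟨v, hv⟩ ⟨y, hy⟩, h ⟨v, hv⟩]

/-- Nonnegativity gives `‖(T - t) x‖ ≥ -t ‖x‖`. Hence `T - t` is injective with closed range, and a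
vector orthogonal to the range lies in the kernel by self-adjointness, so the range is everything.
The same estimate bounds the inverse. -/
lemma mem_resolventSet_of_neg (hT : IsSelfAdjoint T)
    (h0 : ∀ x : T.domain, 0 ≤ inner ℝ (T x) (x : E)) {t : ℝ} (ht : t < 0) :
    t ∈ resolventSet T := by
  set B : T.domain →ₗ[ℝ] E := T.toFun - t • T.domain.subtype with hB
  have hBx : ∀ x : T.domain, B x = T x - t • (x : E) := fun x => rfl
  have hlow : ∀ x : T.domain, -t * ‖(x : E)‖ ≤ ‖B x‖ := by
    intro x
    have h1 : inner ℝ (B x) (x : E) = inner ℝ (T x) (x : E) - t * ‖(x : E)‖ ^ 2 := by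
      rw [hBx, inner_sub_left, real_inner_smul_left, real_inner_self_eq_norm_sq]
    have h2 := real_inner_le_norm (B x) (x : E)
    rcases (norm_nonneg (x : E)).eq_or_lt with hx | hx
    · rw [← hx]; simp
    · refine le_of_mul_le_mul_right ?_ hx
      nlinarith [h0 x]
  have hsymm : ∀ x y : T.domain, inner ℝ (B x) (y : E) = inner ℝ (x : E) (B y) := by
    intro x y
    rw [hBx, hBx, inner_sub_left, inner_sub_right, inner_map_symm hT, real_inner_smul_left,
      real_inner_smul_right]
  have hmax : ∀ y z : E, (∀ x : T.domain, inner ℝ (B x) y = inner ℝ (x : E) z) →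
      ∃ x : T.domain, (x : E) = y ∧ B x = z := by
    intro y z h
    obtain ⟨hy, hyz⟩ := exists_map_eq_of_inner hT (y := y) (z := z + t • y) (fun x => by
      have := h x
      rw [hBx, inner_sub_left, real_inner_smul_left] at this
      rw [inner_add_right, real_inner_smul_right]
      linarith)
    exact ⟨⟨y, hy⟩, rfl, by rw [hBx, hyz]; simp⟩
  have hinj : Function.Injective B := by
    rw [← LinearMap.ker_eq_bot, LinearMap.ker_eq_bot']
    intro x hx
    have := hlow x
    rw [hx, norm_zero] at this
    have h3 : ‖(x : E)‖ ≤ 0 := by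
      by_contra hne
      nlinarith
    exact Subtype.ext (norm_le_zero_iff.1 h3)
  have hclosed : IsClosed (LinearMap.range B : Set E) := by
    refine isClosed_of_closure_subset fun y hy => ?_
    obtain ⟨s, hs, hsy⟩ := mem_closure_iff_seq_limit.1 hy
    choose x hx using hs
    have hc : CauchySeq fun n => (x n : E) := by
      have hcs := hsy.cauchySeq
      rw [Metric.cauchySeq_iff'] at hcs ⊢
      intro ε hε
      obtain ⟨n, hn⟩ := hcs (-t * ε) (by nlinarith)
      refine ⟨n, fun m hm => ?_⟩
      have h1 := hn m hm
      rw [dist_eq_norm, ← hx, ← hx, ← map_sub] at h1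
      have h2 := hlow (x m - x n)
      rw [dist_eq_norm]
      rw [Submodule.coe_sub] at h2
      exact lt_of_mul_lt_mul_left (h2.trans_lt h1) (by linarith)
    obtain ⟨z, hz⟩ := cauchySeq_tendsto_of_complete hc
    obtain ⟨w, -, hw⟩ := hmax z y (fun ξ => by
      have l1 : Tendsto (fun n => inner ℝ (B ξ) (x n : E)) atTop (𝓝 (inner ℝ (B ξ) z)) :=
        tendsto_const_nhds.inner hz
      have l2 : Tendsto (fun n => inner ℝ (ξ : E) (s n)) atTop (𝓝 (inner ℝ (ξ : E) y)) :=
        tendsto_const_nhds.inner hsy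
      refine tendsto_nhds_unique l1 (l2.congr fun n => ?_)
      rw [hsymm, hx])
    exact ⟨w, hw⟩
  have hsurj : Function.Surjective B := by
    rw [← LinearMap.range_eq_top]
    have : CompleteSpace (LinearMap.range B) := hclosed.completeSpace_coe
    rw [← Submodule.orthogonal_eq_bot_iff, Submodule.eq_bot_iff]
    intro y hy
    obtain ⟨x, hxy, hx⟩ := hmax y 0 (fun ξ => by
      rw [inner_zero_right]
      exact hy (B ξ) ⟨ξ, rfl⟩)
    have : x = 0 := hinj (by rw [hx, map_zero])
    rw [← hxy, this]
    rfl
  set e := LinearEquiv.ofBijective B ⟨hinj, hsurj⟩ with he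
  have hBe : ∀ y, B (e.symm y) = y := fun y => e.apply_symm_apply y
  let R : E →L[ℝ] E := (T.domain.subtype ∘ₗ (e.symm : E →ₗ[ℝ] T.domain)).mkContinuous (-t)⁻¹
    (fun y => by
      have := hlow (e.symm y)
      rw [hBe] at this
      rw [← div_eq_inv_mul, le_div_iff₀ (by linarith), mul_comm]
      exact this)
  have hR : ∀ y, R y = (e.symm y : E) := fun y => rfl
  refine ⟨R, fun y => ⟨(e.symm y).2, ?_⟩, fun x => ?_⟩
  · exact hBe y
  · rw [hR, ← hBx]
    exact congrArg Subtype.val (e.symm_apply_apply x)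

/-- A self-adjoint operator that is bounded below, whose form is nonnegative on the kernel of a
linear functional but not everywhere, has a negative eigenvalue. -/
lemma exists_neg_eigenvector (hT : IsSelfAdjoint T) {M : ℝ}
    (hM : ∀ x : T.domain, M * ‖(x : E)‖ ^ 2 ≤ inner ℝ (T x) (x : E)) (ℓ : T.domain →ₗ[ℝ] ℝ)
    (hℓ : ∀ x : T.domain, ℓ x = 0 → 0 ≤ inner ℝ (T x) (x : E))
    {x₀ : T.domain} (hx₀ : inner ℝ (T x₀) (x₀ : E) < 0) :
    ∃ t : ℝ, t < 0 ∧ ∃ x : T.domain, x ≠ 0 ∧ T x = t • (x : E) := by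
  set S : Set ℝ := {r | ∃ x : T.domain, ‖(x : E)‖ = 1 ∧ inner ℝ (T x) (x : E) = r} with hS
  have hsc : ∀ (a : ℝ) (x : T.domain),
      inner ℝ (T (a • x)) ((a • x : T.domain) : E) = a ^ 2 * inner ℝ (T x) (x : E) := by
    intro a x
    rw [T.map_smul, Submodule.coe_smul, real_inner_smul_left, real_inner_smul_right]
    ring
  have hnormalize : ∀ x : T.domain, (x : E) ≠ 0 →
      inner ℝ (T x) (x : E) / ‖(x : E)‖ ^ 2 ∈ S := by
    intro x hx
    have hx' := norm_pos_iff.2 hx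
    refine ⟨‖(x : E)‖⁻¹ • x, ?_, ?_⟩
    · rw [Submodule.coe_smul, norm_smul, norm_inv, norm_norm, inv_mul_cancel₀ hx'.ne']
    · rw [hsc]
      field_simp
  have hbdd : BddBelow S := by
    refine ⟨M, ?_⟩
    rintro r ⟨x, hx, rfl⟩
    have := hM x
    rwa [hx, one_pow, mul_one] at this
  have hx₀' : (x₀ : E) ≠ 0 := by
    intro h
    rw [h, inner_zero_right] at hx₀
    exact lt_irrefl _ hx₀
  have hne : S.Nonempty := ⟨_, hnormalize x₀ hx₀'⟩
  -- The bottom of the Rayleigh quotient. It is shown to be attained: every normalised minimising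
  -- sequence in `ℓ > 0` is Cauchy, so neither compactness nor continuity of `ℓ` is needed.
  set t := sInf S with ht
  have ht0 : t < 0 := (csInf_le hbdd (hnormalize x₀ hx₀')).trans_lt
    (div_neg_of_neg_of_pos hx₀ (by have := norm_pos_iff.2 hx₀'; positivity))
  set b : T.domain → T.domain → ℝ := fun x y => inner ℝ (T x) (y : E) - t * inner ℝ (x : E) (y : E)
    with hb
  have hb0 : ∀ x, 0 ≤ b x x := by
    intro x
    simp only [hb, real_inner_self_eq_norm_sq]
    by_cases hx : (x : E) = 0
    · simp [hx]
    · have h1 := csInf_le hbdd (hnormalize x hx)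
      have h2 : 0 < ‖(x : E)‖ ^ 2 := by have := norm_pos_iff.2 hx; positivity
      rw [← ht, le_div_iff₀ h2] at h1
      linarith
  have hexp : ∀ (p q : ℝ) (x y : T.domain), b (p • x + q • y) (p • x + q • y)
      = p ^ 2 * b x x + 2 * p * q * b x y + q ^ 2 * b y y := by
    intro p q x y
    have h1 : inner ℝ (T y) (x : E) = inner ℝ (T x) (y : E) := by
      rw [inner_map_symm hT, real_inner_comm]
    simp only [hb, T.map_add, T.map_smul, Submodule.coe_add, Submodule.coe_smul, inner_add_left,
      inner_add_right, real_inner_smul_left, real_inner_smul_right, h1,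
      real_inner_comm (x : E) (y : E)]
    ring
  have hCS : ∀ x y, b x y ^ 2 ≤ b x x * b y y := by
    intro x y
    have h := discrim_le_zero (a := b y y) (b := 2 * b x y) (c := b x x) (fun s => by
      have := hb0 ((1 : ℝ) • x + s • y)
      rw [hexp] at this
      linarith)
    rw [discrim] at h
    linarith
  have hseq : ∀ n : ℕ, ∃ x : T.domain, ‖(x : E)‖ = 1 ∧ 0 < ℓ x ∧ b x x < -t / (n + 1) := by
    intro n
    have hpos : 0 < -t / (n + 1 : ℝ) := div_pos (by linarith) (by positivity)
    obtain ⟨r, ⟨x, hx, rfl⟩, hr⟩ := exists_lt_of_csInf_lt hne (lt_add_of_pos_right t hpos)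
    have hbx : b x x < -t / (n + 1) := by
      simp only [hb, real_inner_self_eq_norm_sq, hx]
      linarith
    -- This excludes `ℓ x = 0`, where the form is nonnegative and so `b x x ≥ -t`. Otherwise the
    -- sign of `x` can be chosen so that `ℓ x > 0`.
    have hle : -t / (n + 1 : ℝ) ≤ -t := div_le_self (by linarith) (by linarith [n.cast_nonneg (α := ℝ)])
    rcases lt_trichotomy (ℓ x) 0 with h | h | h
    · refine ⟨-x, by simpa using hx, by simpa using h, ?_⟩
      have := hexp (-1) 0 x x
      simp only [neg_smul, one_smul, zero_smul, add_zero] at this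
      rw [this]
      linarith
    · have := hℓ x h
      simp only [hb, real_inner_self_eq_norm_sq, hx] at hbx
      linarith
    · exact ⟨x, hx, h, hbx⟩
  choose x hx1 hxℓ hxb using hseq
  have hdist : ∀ m n : ℕ, ‖(x m : E) - x n‖ ^ 2 ≤ 8 * (1 / (m + 1) + 1 / (n + 1)) := by
    intro m n
    set p := ℓ (x n)
    set q := ℓ (x m)
    have hp : 0 < p := hxℓ n
    have hq : 0 < q := hxℓ m
    set c := inner ℝ (x m : E) (x n : E) with hc
    have hc1 : |c| ≤ 1 := by
      have := abs_real_inner_le_norm (x m : E) (x n : E)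
      rwa [hx1, hx1, one_mul] at this
    -- This combination lies in the kernel of `ℓ`, where `b` dominates `-t` times the squared norm.
    -- As `b` is small on both vectors, the combination is nearly zero, so the two unit vectors are
    -- nearly parallel.
    have hz := hℓ (p • x m + (-q) • x n) (by
      simp only [map_add, map_smul, smul_eq_mul, p, q]
      ring)
    have hn : ‖((p • x m + (-q) • x n : T.domain) : E)‖ ^ 2 = p ^ 2 + q ^ 2 - 2 * p * q * c := by
      rw [Submodule.coe_add, Submodule.coe_smul, Submodule.coe_smul, norm_add_sq_real, norm_smul,
        norm_smul, real_inner_smul_left, real_inner_smul_right, hx1, hx1, mul_one, mul_one,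
        Real.norm_eq_abs, Real.norm_eq_abs, sq_abs, sq_abs, ← hc]
      ring
    have h1 : -t * (p ^ 2 + q ^ 2 - 2 * p * q * c)
        ≤ b (p • x m + (-q) • x n) (p • x m + (-q) • x n) := by
      have : b (p • x m + (-q) • x n) (p • x m + (-q) • x n)
        = inner ℝ (T (p • x m + (-q) • x n)) ((p • x m + (-q) • x n : T.domain) : E)
          - t * ‖((p • x m + (-q) • x n : T.domain) : E)‖ ^ 2 := by
        simp only [hb, real_inner_self_eq_norm_sq]
      rw [this, hn]
      linarith
    -- Parallelogram identity for `b`, dropping the nonnegative term with the plus sign.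
    have h2 : b (p • x m + (-q) • x n) (p • x m + (-q) • x n)
        ≤ 2 * (p ^ 2 * b (x m) (x m) + q ^ 2 * b (x n) (x n)) := by
      have e1 := hexp p (-q) (x m) (x n)
      have e2 := hexp p q (x m) (x n)
      have e3 := hb0 (p • x m + q • x n)
      rw [e2] at e3
      rw [e1]
      linarith
    have hbm := hxb m
    have hbn := hxb n
    set εm : ℝ := 1 / (m + 1) with hεm
    set εn : ℝ := 1 / (n + 1) with hεn
    have hm0 : 0 < εm := by positivity
    have hn0 : 0 < εn := by positivity
    have hbm' : b (x m) (x m) ≤ -t * εm := by rw [hεm, mul_one_div]; exact hbm.le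
    have hbn' : b (x n) (x n) ≤ -t * εn := by rw [hεn, mul_one_div]; exact hbn.le
    have h3 : p ^ 2 + q ^ 2 - 2 * p * q * c ≤ 2 * (p ^ 2 + q ^ 2) * (εm + εn) := by
      have h4 : -t * (p ^ 2 + q ^ 2 - 2 * p * q * c)
          ≤ -t * (2 * (p ^ 2 + q ^ 2) * (εm + εn)) := by
        have a1 := mul_le_mul_of_nonneg_left hbm' (sq_nonneg p)
        have a2 := mul_le_mul_of_nonneg_left hbn' (sq_nonneg q)
        have a3 : 0 ≤ -t * (p ^ 2 * εn) :=
          mul_nonneg (by linarith) (by positivity)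
        have a4 : 0 ≤ -t * (q ^ 2 * εm) :=
          mul_nonneg (by linarith) (by positivity)
        linarith
      exact le_of_mul_le_mul_left h4 (by linarith)
    -- For `c ≥ 0` use `2pq ≤ p² + q²`. For `c ≤ 0` the cross term helps because `p q > 0`: this is
    -- where the common sign of `ℓ` rules out nearly opposite vectors.
    have h5 : (1 - c) * (p ^ 2 + q ^ 2) ≤ 2 * (p ^ 2 + q ^ 2 - 2 * p * q * c) := by
      have hpq : 0 < p * q := mul_pos hp hq
      rcases le_total 0 c with h0 | h0
      · nlinarith [mul_nonneg h0 (sq_nonneg (p - q)), (abs_le.1 hc1).2,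
          mul_nonneg (sub_nonneg.2 (abs_le.1 hc1).2) (add_nonneg (sq_nonneg p) (sq_nonneg q))]
      · nlinarith [mul_nonneg (neg_nonneg.2 h0) hpq.le,
          mul_nonneg (by linarith [(abs_le.1 hc1).1] : 0 ≤ 1 + c)
            (add_nonneg (sq_nonneg p) (sq_nonneg q))]
    have h6 : 1 - c ≤ 4 * (εm + εn) := by
      refine le_of_mul_le_mul_right ?_ (by positivity : 0 < p ^ 2 + q ^ 2)
      linarith
    rw [norm_sub_sq_real, hx1, hx1, ← hc]
    linarith
  have hε : Tendsto (fun n : ℕ => 1 / ((n : ℝ) + 1)) atTop (𝓝 0) :=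
    tendsto_one_div_add_atTop_nhds_zero_nat
  have hcauchy : CauchySeq fun n => (x n : E) := by
    rw [Metric.cauchySeq_iff]
    intro ε hε0
    obtain ⟨k, hk⟩ := eventually_atTop.1
      (hε.eventually_lt_const (by positivity : 0 < ε ^ 2 / 16))
    refine ⟨k, fun m hm n hn => ?_⟩
    rw [dist_eq_norm]
    refine lt_of_pow_lt_pow_left₀ 2 hε0.le ((hdist m n).trans_lt ?_)
    linarith [hk m hm, hk n hn]
  obtain ⟨y, hy⟩ := cauchySeq_tendsto_of_complete hcauchy
  have hy1 : ‖y‖ = 1 := tendsto_nhds_unique hy.norm (by simp [hx1])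
  obtain ⟨hyd, hyt⟩ := exists_map_eq_of_inner hT (y := y) (z := t • y) (fun w => by
    have l1 : Tendsto (fun n => b w (x n)) atTop (𝓝 (inner ℝ (T w) y - t * inner ℝ (w : E) y)) :=
      (tendsto_const_nhds.inner hy).sub ((tendsto_const_nhds.inner hy).const_mul t)
    have l2 : Tendsto (fun n => b w (x n)) atTop (𝓝 0) := by
      have l3 : Tendsto (fun n : ℕ => b w w * (-t * (1 / ((n : ℝ) + 1)))) atTop (𝓝 0) := by
        simpa using (hε.const_mul (-t)).const_mul (b w w)
      have l4 : Tendsto (fun n => b w (x n) ^ 2) atTop (𝓝 0) := by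
        refine squeeze_zero (fun n => sq_nonneg _) (fun n => (hCS w (x n)).trans ?_) l3
        refine mul_le_mul_of_nonneg_left ?_ (hb0 w)
        rw [mul_one_div]
        exact (hxb n).le
      have l5 := l4.sqrt
      simp only [Real.sqrt_sq_eq_abs, Real.sqrt_zero] at l5
      exact (tendsto_zero_iff_abs_tendsto_zero _).2 l5
    have := tendsto_nhds_unique l1 l2
    rw [real_inner_smul_right]
    linarith)
  refine ⟨t, ht0, ⟨y, hyd⟩, fun h => ?_, hyt⟩
  have : y = 0 := congrArg Subtype.val h
  rw [this, norm_zero] at hy1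
  exact zero_ne_one hy1

/-- Any two eigenvectors with negative eigenvalues have a combination in the kernel of `ℓ`, where
the form is nonnegative although it is nonpositive on their span; they are therefore proportional.
-/
lemma morseIndex_eq_one (hT : IsSelfAdjoint T) {M : ℝ}
    (hM : ∀ x : T.domain, M * ‖(x : E)‖ ^ 2 ≤ inner ℝ (T x) (x : E)) (ℓ : T.domain →ₗ[ℝ] ℝ)
    (hℓ : ∀ x : T.domain, ℓ x = 0 → 0 ≤ inner ℝ (T x) (x : E))
    {x₀ : T.domain} (hx₀ : inner ℝ (T x₀) (x₀ : E) < 0) : morseIndex T = 1 := by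
  obtain ⟨t, ht, x, hx, hxt⟩ := exists_neg_eigenvector hT hM ℓ hℓ hx₀
  have hx' : (x : E) ≠ 0 := fun h => hx (Subtype.ext h)
  have key : ∀ (s : ℝ) (y : T.domain), s < 0 → T y = s • (y : E) → ℓ y = 0 → (y : E) = 0 := by
    intro s y hs hy h
    have := hℓ y h
    rw [hy, real_inner_smul_left, real_inner_self_eq_norm_sq] at this
    by_contra hne
    have := norm_pos_iff.2 hne
    nlinarith [pow_pos this 2]
  have hℓx : ℓ x ≠ 0 := fun h => hx' (key t x ht hxt h)
  rw [morseIndex, rank_submodule_eq_one_iff]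
  refine ⟨x, ?_, hx', ?_⟩
  · exact Submodule.mem_iSup_of_mem ⟨t, ht⟩ (mem_eigenspace_iff.2 ⟨x.2, hxt⟩)
  · refine iSup_le ?_
    rintro ⟨s, hs⟩ y hy
    obtain ⟨hyd, hys⟩ := mem_eigenspace_iff.1 hy
    have hs : s < 0 := hs
    set w : T.domain := ⟨y, hyd⟩ with hw
    change T w = s • (w : E) at hys
    change (w : E) ∈ _
    set z : T.domain := ℓ x • w + (-ℓ w) • x with hz
    have hzℓ : ℓ z = 0 := by
      simp only [hz, map_add, map_smul, smul_eq_mul]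
      ring
    have h1 := hℓ z hzℓ
    have hst : (s - t) * inner ℝ (w : E) (x : E) = 0 := by
      have := inner_map_symm hT w x
      rw [hys, hxt, real_inner_smul_left, real_inner_smul_right] at this
      linarith
    have hTz : T z = (ℓ x * s) • (w : E) + (-ℓ w * t) • (x : E) := by
      rw [hz, T.map_add, T.map_smul, T.map_smul, hys, hxt, smul_smul, smul_smul]
    -- For equal eigenvalues `z` satisfies the eigenvalue equation with `ℓ z = 0`. For different
    -- ones `w` and `x` are orthogonal, so the form at `z` is a sum of two nonpositive terms that
    -- must both vanish.
    have hz0 : (z : E) = 0 := by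
      by_cases hst' : s = t
      · refine key t z ht ?_ hzℓ
        rw [hTz, hz, hst']
        simp only [Submodule.coe_add, Submodule.coe_smul, smul_add, smul_smul]
        rw [mul_comm t, mul_comm t]
      · have hin : inner ℝ (w : E) (x : E) = 0 := by
          rcases mul_eq_zero.1 hst with h | h
          · exact absurd (sub_eq_zero.1 h) hst'
          · exact h
        have h2 : inner ℝ (T z) (z : E)
            = ℓ x ^ 2 * (s * ‖(w : E)‖ ^ 2) + ℓ w ^ 2 * (t * ‖(x : E)‖ ^ 2) := by
          rw [hTz, hz]
          simp only [Submodule.coe_add, Submodule.coe_smul, inner_add_left, inner_add_right,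
            real_inner_smul_left, real_inner_smul_right, hin, real_inner_comm (w : E) (x : E),
            real_inner_self_eq_norm_sq]
          ring
        rw [h2] at h1
        have a1 : 0 < ‖(x : E)‖ ^ 2 := by have := norm_pos_iff.2 hx'; positivity
        have a2 : 0 ≤ ℓ x ^ 2 * (-s * ‖(w : E)‖ ^ 2) :=
          mul_nonneg (sq_nonneg _) (mul_nonneg (by linarith) (sq_nonneg _))
        have a3 : 0 ≤ ℓ w ^ 2 * (-t * ‖(x : E)‖ ^ 2) :=
          mul_nonneg (sq_nonneg _) (mul_nonneg (by linarith) (sq_nonneg _))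
        have a4 : ℓ w = 0 := by
          have a5 : ℓ w ^ 2 * (-t * ‖(x : E)‖ ^ 2) = 0 := by linarith
          rcases mul_eq_zero.1 a5 with h | h
          · exact pow_eq_zero_iff two_ne_zero |>.1 h
          · nlinarith
        have a6 := key s w hs hys a4
        rw [hz]
        simp [a4, a6]
    rw [Submodule.mem_span_singleton]
    refine ⟨ℓ w / ℓ x, ?_⟩
    rw [hz, Submodule.coe_add, Submodule.coe_smul, Submodule.coe_smul, neg_smul,
      ← sub_eq_add_neg, sub_eq_zero] at hz0
    rw [div_eq_inv_mul, mul_smul, ← hz0, smul_smul, inv_mul_cancel₀ hℓx, one_smul]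

end Operators

/-! ### Self-adjointness on the star graph -/

lemma inner_eq_sum_integral {N : ℕ} (Ψ Φ : GraphL2 N) :
    inner ℝ Ψ Φ = ∑ i, ∫ x in Ioi (0 : ℝ), Ψ i x * Φ i x := by
  rw [PiLp.inner_apply]
  refine Finset.sum_congr rfl fun i _ => ?_
  rw [L2.inner_def]
  simp only [RCLike.inner_apply, conj_trivial, mul_comm]

lemma isTest_zero : IsTest fun _ => 0 := by
  refine ⟨contDiff_const, HasCompactSupport.zero, ?_⟩
  have : tsupport (fun _ : ℝ => (0 : ℝ)) = ∅ := by
    rw [tsupport_eq_empty_iff]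
    rfl
  simp [this]

/-- A family of test functions, one on each edge, lies in `𝒟(H)`. -/
lemma isDeltaData_of_isTest {N : ℕ} (α : ℝ) {η : Fin N → ℝ → ℝ} (h : ∀ i, IsTest (η i)) :
    IsDeltaData α (WithLp.toLp 2 fun i => (h i).memLp.toLp (η i) : GraphL2 N)
      (WithLp.toLp 2 fun i => (h i).deriv.memLp.toLp _)
      (WithLp.toLp 2 fun i => (h i).deriv.deriv.memLp.toLp _) :=
  isDeltaData_of_isRepr (c := 0) (fun i => (h i).isRepr)
    (fun i => (h i).eq_zero_of_nonpos le_rfl)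
    (by simp [fun i => (h i).deriv.eq_zero_of_nonpos le_rfl])

lemma integral_toLp_mul {w : ℝ → ℝ} (hw : MemLp w 2 halfLine) (f : EdgeL2) :
    ∫ x in Ioi (0 : ℝ), hw.toLp w x * f x = ∫ x in Ioi (0 : ℝ), f x * w x := by
  apply integral_congr_ae
  filter_upwards [hw.coeFn_toLp] with x hx
  rw [hx, mul_comm]

lemma isTest_ite {N : ℕ} {η : ℝ → ℝ} (hη : IsTest η) (k i : Fin N) :
    IsTest (if i = k then η else fun _ => 0) := by
  split_ifs
  exacts [hη, isTest_zero]

lemma inner_toLp_isTest {N : ℕ} {w : Fin N → ℝ → ℝ} (hw : ∀ i, MemLp (w i) 2 halfLine)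
    {k : Fin N} (h0 : ∀ i, i ≠ k → w i = 0) (y : GraphL2 N) :
    inner ℝ (WithLp.toLp 2 fun i => (hw i).toLp (w i) : GraphL2 N) y
      = ∫ x in Ioi (0 : ℝ), y k x * w k x := by
  rw [inner_eq_sum_integral, Finset.sum_eq_single k]
  · exact integral_toLp_mul (hw k) (y k)
  · intro i _ hi
    have := integral_toLp_mul (hw i) (y i)
    refine this.trans ?_
    simp [h0 i hi]
  · simp

lemma dense_deltaDomain (N : ℕ) (α : ℝ) : Dense (deltaDomain N α : Set (GraphL2 N)) := by
  rw [Submodule.dense_iff_topologicalClosure_eq_top, Submodule.topologicalClosure_eq_top_iff,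
    Submodule.eq_bot_iff]
  intro y hy
  refine PiLp.ext fun k => ?_
  refine Lp.ext ((ae_eq_of_forall_isTest (LocInt.of_memLp (Lp.memLp (y k)))
    (isPrimitive_const 0).locInt fun η hη => ?_).trans (Lp.coeFn_zero ℝ 2 halfLine).symm)
  have h1 := hy _ ⟨_, _, isDeltaData_of_isTest α (isTest_ite hη k)⟩
  rw [inner_toLp_isTest _ (k := k) (fun i hi => by rw [if_neg hi]; rfl)] at h1
  simpa using h1

/-- The formal adjoint of `H` has no larger domain than `H`. -/
lemma exists_isDeltaData_of_inner {N : ℕ} (hN : 0 < N) {α : ℝ} {y z : GraphL2 N}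
    (h : ∀ Φ Φ' Φ'', IsDeltaData α Φ Φ' Φ'' → inner ℝ Φ'' y = inner ℝ Φ z) :
    ∃ y', IsDeltaData α y y' z := by
  have hedge : ∀ k, ∃ (f' : EdgeL2) (u v : ℝ → ℝ), IsRepr (y k) f' (z k) u v := by
    intro k
    obtain ⟨u, v, hu, huv, hv⟩ := exists_isPrimitive_of_second
      (LocInt.of_memLp (Lp.memLp (y k))) (LocInt.of_memLp (Lp.memLp (z k))) (fun η hη => by
        have h1 := h _ _ _ (isDeltaData_of_isTest α (isTest_ite hη k))
        rw [inner_toLp_isTest _ (k := k) (fun i hi => by rw [if_neg hi]; ext; simp),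
          inner_toLp_isTest _ (k := k) (fun i hi => by rw [if_neg hi]; rfl)] at h1
        simpa using h1)
    have hv2 : MemLp v 2 halfLine :=
      huv.memLp_deriv hv ((memLp_congr_ae hu).1 (Lp.memLp (y k))) (Lp.memLp (z k))
    exact ⟨hv2.toLp v, u, v, hu, hv2.coeFn_toLp, huv, hv⟩
  choose f' u v huv using hedge
  have hgreen : ∀ (c : ℝ) (d : Fin N → ℝ), ∑ i, d i = α * c →
      ∑ i, (c * v i 0 - d i * u i 0) = 0 := by
    intro c d hcd
    choose g g' g'' p q hpq hp hq using fun i => exists_isRepr_vertex c (d i)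
    have h1 := h (WithLp.toLp 2 g) (WithLp.toLp 2 g') (WithLp.toLp 2 g'')
      (isDeltaData_of_isRepr (u := p) (v := q) hpq hp
        ((Finset.sum_congr rfl fun i _ => hq i).trans hcd))
    rw [inner_eq_sum_integral, inner_eq_sum_integral, ← sub_eq_zero,
      ← Finset.sum_sub_distrib] at h1
    refine (Finset.sum_congr rfl fun i _ => ?_).trans h1
    have := (hpq i).integral_green (huv i)
    rw [hp, hq] at this
    exact this.symm
  set o : Fin N := ⟨0, hN⟩
  refine ⟨WithLp.toLp 2 f', isDeltaData_of_isRepr (u := u) (v := v) (c := u o 0) huv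
    (fun i => ?_) ?_⟩
  -- Vertex value `0` with slopes `1` on edge `i` and `-1` on edge `o` isolates `u i 0 = u o 0`.
  · have := hgreen 0 (fun k => (if k = i then 1 else 0) - if k = o then 1 else 0)
      (by simp [Finset.sum_sub_distrib])
    simp only [zero_mul, zero_sub, sub_mul, ite_mul, one_mul, Finset.sum_neg_distrib,
      Finset.sum_sub_distrib, Finset.sum_ite_eq', Finset.mem_univ, if_true] at this
    linarith
  -- Vertex value `1` with the whole slope `α` on edge `o` yields the derivative condition.
  · have := hgreen 1 (fun k => if k = o then α else 0) (by simp)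
    simp only [one_mul, ite_mul, zero_mul, Finset.sum_sub_distrib, Finset.sum_ite_eq',
      Finset.mem_univ, if_true] at this
    linarith

variable {N : ℕ} {α ω μ : ℝ}

lemma coeFn_potentialMul (hμ : 0 < μ) (Ψ : GraphL2 N) (k : Fin N) :
    potentialMul N α ω hμ Ψ k
      =ᵐ[halfLine] fun x => |groundStateFun N α ω μ k x| ^ (2 * μ) * Ψ k x := by
  filter_upwards [coeFn_edgeMul (potential N α ω hμ k) (Ψ k),
    (memLp_potential N α ω hμ k).coeFn_toLp] with x h1 h2
  rw [← h2]
  exact h1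

lemma inner_potentialMul_symm (hμ : 0 < μ) (Ψ Φ : GraphL2 N) :
    inner ℝ (potentialMul N α ω hμ Ψ) Φ = inner ℝ Ψ (potentialMul N α ω hμ Φ) := by
  rw [inner_eq_sum_integral, inner_eq_sum_integral]
  refine Finset.sum_congr rfl fun i _ => integral_congr_ae ?_
  filter_upwards [coeFn_potentialMul (α := α) (ω := ω) hμ Ψ i,
    coeFn_potentialMul (α := α) (ω := ω) hμ Φ i] with x h1 h2
  rw [h1, h2]
  ring

lemma linearized_apply (hμ : 0 < μ) (κ : ℝ) (Ψ : (linearized N α ω hμ κ).domain)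
    {Ψ' Ψ'' : GraphL2 N} (h : IsDeltaData α (Ψ : GraphL2 N) Ψ' Ψ'') :
    linearized N α ω hμ κ Ψ
      = -Ψ'' + ω • (Ψ : GraphL2 N) - κ • potentialMul N α ω hμ (Ψ : GraphL2 N) := by
  rw [← secondDeriv_eq (Ψ : deltaDomain N α) h]
  rfl

lemma isSelfAdjoint_linearized (hN : 0 < N) (hμ : 0 < μ) (κ : ℝ) :
    IsSelfAdjoint (linearized N α ω hμ κ) := by
  refine isSelfAdjoint_of_symmetric (dense_deltaDomain N α) (fun Ψ Φ => ?_) fun y z h => ?_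
  · obtain ⟨Ψ', Ψ'', hΨ⟩ := Ψ.2
    obtain ⟨Φ', Φ'', hΦ⟩ := Φ.2
    rw [linearized_apply hμ κ Ψ hΨ, linearized_apply hμ κ Φ hΦ]
    simp only [inner_sub_left, inner_sub_right, inner_add_left, inner_add_right, inner_neg_left,
      inner_neg_right, real_inner_smul_left, real_inner_smul_right, hΨ.green hΦ,
      inner_potentialMul_symm]
  -- The zeroth-order terms are symmetric and everywhere defined, so they move onto `y`; the vector
  -- supplied is `y''` as solved from the equation with right-hand side `z`.
  · obtain ⟨y', hy⟩ := exists_isDeltaData_of_inner hN (α := α) (y := y)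
      (z := ω • y - κ • potentialMul N α ω hμ y - z) (fun Φ Φ' Φ'' hΦ => by
        have := h ⟨Φ, Φ', Φ'', hΦ⟩
        rw [linearized_apply hμ κ _ hΦ] at this
        simp only [inner_sub_left, inner_add_left, inner_neg_left, real_inner_smul_left,
          inner_potentialMul_symm] at this
        simp only [inner_sub_right, real_inner_smul_right]
        linarith)
    exact ⟨y', _, hy⟩

/-! ### Jacobi factorisation of the form and square integrable solutions -/

/-- `ρ = h' / h` for a positive square integrable solution `h` of `-h'' + Q h = 0`; both `ρ` and
`ρ' = Q - ρ²` are bounded on the half line. -/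
structure IsRiccati (Q ρ h : ℝ → ℝ) : Prop where
  hasDerivAt : ∀ x, 0 ≤ x → HasDerivAt ρ (Q x - ρ x ^ 2) x
  continuousOn : ContinuousOn Q (Ici 0)
  bounded : ∃ C, ∀ x, 0 ≤ x → |ρ x| ≤ C
  sol_hasDerivAt : ∀ x, 0 ≤ x → HasDerivAt h (ρ x * h x) x
  sol_pos : ∀ x, 0 ≤ x → 0 < h x
  sol_memLp : MemLp h 2 halfLine

namespace IsRiccati

variable {Q ρ h : ℝ → ℝ} {f f' f'' : EdgeL2} {u v : ℝ → ℝ}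

lemma continuousOn_rho (H : IsRiccati Q ρ h) : ContinuousOn ρ (Ici 0) :=
  fun x hx => (H.hasDerivAt x hx).continuousAt.continuousWithinAt

lemma isPrimitive_rho (H : IsRiccati Q ρ h) : IsPrimitive ρ (fun x => Q x - ρ x ^ 2) :=
  IsPrimitive.of_hasDerivAt H.hasDerivAt (H.continuousOn.sub (H.continuousOn_rho.pow 2))

lemma isPrimitive_sol (H : IsRiccati Q ρ h) : IsPrimitive h (fun x => ρ x * h x) :=
  IsPrimitive.of_hasDerivAt H.sol_hasDerivAt
    (H.continuousOn_rho.mul fun x hx => (H.sol_hasDerivAt x hx).continuousAt.continuousWithinAt)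

lemma isPrimitive_residual (H : IsRiccati Q ρ h) (hu : IsRepr f f' f'' u v) :
    IsPrimitive (fun x => v x - ρ x * u x)
      (fun x => f'' x - ((Q x - ρ x ^ 2) * u x + ρ x * v x)) :=
  hu.prim_deriv.sub (H.isPrimitive_rho.mul hu.prim)

/-- Boundedness of `ρ` enters here; it is what removes the boundary term at infinity in the
factorised form. -/
lemma memLp_residual (H : IsRiccati Q ρ h) (hu : IsRepr f f' f'' u v) :
    MemLp (fun x => v x - ρ x * u x) 2 halfLine := by
  obtain ⟨C, hC⟩ := H.bounded
  have hρ : MemLp ρ ∞ halfLine := by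
    refine memLp_top_of_bound ((H.continuousOn_rho.mono Ioi_subset_Ici_self).aestronglyMeasurable
      measurableSet_Ioi) C ?_
    filter_upwards [ae_restrict_mem measurableSet_Ioi] with x hx
    exact hC x (le_of_lt hx)
  exact hu.memLp_deriv.sub (hu.memLp.mul' hρ)

/-- Jacobi's factorisation of the quadratic form of `-d²/dx² + Q`. -/
lemma integral_form (H : IsRiccati Q ρ h) (hu : IsRepr f f' f'' u v) {F : EdgeL2}
    (hF : F =ᵐ[halfLine] fun x => -f'' x + Q x * f x) :
    ∫ x in Ioi (0 : ℝ), F x * f x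
      = (∫ x in Ioi (0 : ℝ), (v x - ρ x * u x) ^ 2) + u 0 * (v 0 - ρ 0 * u 0) := by
  have hg := H.memLp_residual hu
  have hp : IsPrimitive (fun x => u x * (v x - ρ x * u x))
      (fun x => (v x - ρ x * u x) ^ 2 - F x * f x) := by
    refine (hu.prim.mul (H.isPrimitive_residual hu)).congr_deriv ?_
    filter_upwards [hF, hu.ae_eq] with x h1 h2
    rw [h1, h2]
    ring
  have i1 : Integrable (fun x => (v x - ρ x * u x) ^ 2) halfLine := hg.integrable_sq
  have i2 : Integrable (fun x => F x * f x) halfLine := (Lp.memLp F).integrable_mul (Lp.memLp f)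
  have := hp.integral_eq_neg (i1.sub i2) (hu.memLp.integrable_mul hg)
  rw [integral_sub i1 i2] at this
  linarith

lemma eq_of_solution (H : IsRiccati Q ρ h) (hu : IsRepr f f' f'' u v)
    (hF : (fun x => -f'' x + Q x * f x) =ᵐ[halfLine] 0) :
    v 0 = ρ 0 * u 0 ∧ ∀ x, 0 ≤ x → u x = u 0 / h 0 * h x := by
  have hg := H.isPrimitive_residual hu
  have hres : ∀ x, 0 ≤ x → v x - ρ x * u x = 0 := by
    -- This is the Wronskian `u' h - u h'`. It is constant for two solutions, and integrable, hence
    -- zero.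
    have hconst : ∀ x, 0 ≤ x →
        (v x - ρ x * u x) * h x = (v 0 - ρ 0 * u 0) * h 0 := by
      intro x hx
      refine (hg.mul H.isPrimitive_sol).eq_const ?_ hx
      filter_upwards [hF, hu.ae_eq] with x h1 h2
      simp only [Pi.zero_apply] at h1 ⊢
      rw [h2] at h1
      linear_combination (-h x) * h1
    have hlim : Tendsto (fun x => (v x - ρ x * u x) * h x) atTop
        (𝓝 ((v 0 - ρ 0 * u 0) * h 0)) := by
      refine tendsto_const_nhds.congr' ?_
      filter_upwards [eventually_ge_atTop 0] with x hx
      exact (hconst x hx).symm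
    have h0 := IsPrimitive.eq_zero_of_tendsto_of_integrable hlim
      ((H.memLp_residual hu).integrable_mul H.sol_memLp)
    intro x hx
    have := hconst x hx
    rw [h0] at this
    exact (mul_eq_zero.1 this).resolve_right (H.sol_pos x hx).ne'
  refine ⟨sub_eq_zero.1 (hres 0 le_rfl), fun x hx => ?_⟩
  have hinv : IsPrimitive (fun x => (h x)⁻¹) (fun x => -(ρ x * h x) / h x ^ 2) := by
    refine IsPrimitive.of_hasDerivAt
      (fun x hx => (H.sol_hasDerivAt x hx).fun_inv (H.sol_pos x hx).ne') ?_
    have hc : ContinuousOn h (Ici 0) :=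
      fun x hx => (H.sol_hasDerivAt x hx).continuousAt.continuousWithinAt
    exact (H.continuousOn_rho.mul hc).neg.div (hc.pow 2)
      fun x hx => (pow_pos (H.sol_pos x hx) 2).ne'
  have hquot := (hu.prim.mul hinv).eq_const (by
    filter_upwards [ae_restrict_mem measurableSet_Ioi] with y hy
    have hy0 : (0 : ℝ) ≤ y := le_of_lt hy
    have := H.sol_pos y hy0
    have e : v y = ρ y * u y := sub_eq_zero.1 (hres y hy0)
    simp only [Pi.zero_apply]
    rw [e]
    field_simp
    ring) hx
  have := (H.sol_pos x hx).ne'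
  rw [div_eq_mul_inv, ← hquot]
  field_simp

end IsRiccati

/-- The potential `|(Ψ_{ω,0})_k|^{2μ}` as a function. -/
def tailPotential (N : ℕ) (α ω μ x : ℝ) : ℝ :=
  (μ + 1) * ω * (1 - Real.tanh (μ * √ω * (x + tailShift N α ω μ)) ^ 2)

lemma linearized_apply_ae (hμ : 0 < μ) {κ : ℝ}
    (hV : ∀ k x, |groundStateFun N α ω μ k x| ^ (2 * μ) = tailPotential N α ω μ x)
    (Ψ : (linearized N α ω hμ κ).domain) {Ψ' Ψ'' : GraphL2 N}
    (h : IsDeltaData α (Ψ : GraphL2 N) Ψ' Ψ'') (k : Fin N) :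
    linearized N α ω hμ κ Ψ k =ᵐ[halfLine] fun x =>
      -Ψ'' k x + (ω - κ * tailPotential N α ω μ x) * (Ψ : GraphL2 N) k x := by
  have e : linearized N α ω hμ κ Ψ k = -Ψ'' k + ω • (Ψ : GraphL2 N) k
      - κ • potentialMul N α ω hμ (Ψ : GraphL2 N) k := by
    rw [linearized_apply hμ κ Ψ h]
    rfl
  rw [e]
  filter_upwards [Lp.coeFn_sub (-Ψ'' k + ω • (Ψ : GraphL2 N) k)
      (κ • potentialMul N α ω hμ (Ψ : GraphL2 N) k),
    Lp.coeFn_add (-Ψ'' k) (ω • (Ψ : GraphL2 N) k), Lp.coeFn_neg (Ψ'' k),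
    Lp.coeFn_smul ω ((Ψ : GraphL2 N) k),
    Lp.coeFn_smul κ (potentialMul N α ω hμ (Ψ : GraphL2 N) k),
    coeFn_potentialMul (α := α) (ω := ω) hμ (Ψ : GraphL2 N) k] with x h1 h2 h3 h4 h5 h6
  rw [h1, Pi.sub_apply, h2, Pi.add_apply, h3, Pi.neg_apply, h4, Pi.smul_apply, h5, Pi.smul_apply,
    h6, hV, smul_eq_mul, smul_eq_mul]
  ring

lemma linearized_form (hN : 0 < N) (hμ : 0 < μ) {κ : ℝ} {ρ h : ℝ → ℝ}
    (hV : ∀ k x, |groundStateFun N α ω μ k x| ^ (2 * μ) = tailPotential N α ω μ x)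
    (H : IsRiccati (fun x => ω - κ * tailPotential N α ω μ x) ρ h)
    (Ψ : (linearized N α ω hμ κ).domain) {c : ℝ}
    (hc : ∀ i, HasVertexValue ((Ψ : GraphL2 N) i) c) :
    c ^ 2 * (α - N * ρ 0) ≤ inner ℝ (linearized N α ω hμ κ Ψ) (Ψ : GraphL2 N) := by
  obtain ⟨Ψ', Ψ'', hΨ⟩ := Ψ.2
  obtain ⟨u, v, d, huv, hd, hv⟩ := hΨ.exists_isRepr
  have hdc : ∀ i, u i 0 = c := fun i =>
    (hc i).eq_of_ae_eq (huv i).ae_eq (huv i).prim.continuousOn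
  rw [inner_eq_sum_integral, Finset.sum_congr rfl fun i _ =>
    H.integral_form (huv i) (linearized_apply_ae hμ hV Ψ hΨ i), Finset.sum_add_distrib]
  have h1 : 0 ≤ ∑ i, ∫ x in Ioi (0 : ℝ), (v i x - ρ x * u i x) ^ 2 :=
    Finset.sum_nonneg fun i _ => integral_nonneg fun x => sq_nonneg _
  have h2 : ∑ i, u i 0 * (v i 0 - ρ 0 * u i 0) = c ^ 2 * (α - N * ρ 0) := by
    have hdc' : d = c := (hd ⟨0, hN⟩).symm.trans (hdc _)
    simp only [hdc, ← Finset.mul_sum, Finset.sum_sub_distrib, hv, hdc', Finset.sum_const,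
      Finset.card_univ, Fintype.card_fin, nsmul_eq_mul]
    ring
  linarith

lemma exists_edge_of_mem_opKernel (hμ : 0 < μ) {κ : ℝ} {ρ h : ℝ → ℝ}
    (hV : ∀ k x, |groundStateFun N α ω μ k x| ^ (2 * μ) = tailPotential N α ω μ x)
    (H : IsRiccati (fun x => ω - κ * tailPotential N α ω μ x) ρ h) {Ψ : GraphL2 N}
    (hΨ : Ψ ∈ opKernel (linearized N α ω hμ κ)) :
    ∃ c : ℝ, (∀ i, Ψ i =ᵐ[halfLine] fun x => c / h 0 * h x) ∧ c * (α - N * ρ 0) = 0 := by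
  obtain ⟨hd, h0⟩ := mem_opKernel_iff.1 hΨ
  obtain ⟨Ψ', Ψ'', hdata⟩ := id hd
  obtain ⟨u, v, c, huv, hc, hv⟩ := hdata.exists_isRepr
  have key : ∀ i, v i 0 = ρ 0 * u i 0 ∧ ∀ x, 0 ≤ x → u i x = u i 0 / h 0 * h x := by
    intro i
    refine H.eq_of_solution (huv i) ?_
    have := linearized_apply_ae hμ hV ⟨Ψ, hd⟩ hdata i
    refine this.symm.trans ?_
    rw [h0]
    exact Lp.coeFn_zero ℝ 2 halfLine
  refine ⟨c, fun i => ?_, ?_⟩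
  · refine (huv i).ae_eq.trans ?_
    filter_upwards [ae_restrict_mem measurableSet_Ioi] with x hx
    rw [(key i).2 x (le_of_lt hx), hc]
  · rw [Finset.sum_congr rfl fun i _ => (key i).1] at hv
    simp only [hc, Finset.sum_const, Finset.card_univ, Fintype.card_fin, nsmul_eq_mul] at hv
    linarith

lemma HasVertexValue.unique {f : EdgeL2} {c d : ℝ} (h : HasVertexValue f c)
    (k : HasVertexValue f d) : c = d := by
  obtain ⟨u, hu, hfu, rfl⟩ := h
  exact k.eq_of_ae_eq hfu hu

/-- The value at the vertex, as a linear functional on `𝒟(H)`. -/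
lemma exists_vertexValue (hN : 0 < N) (α : ℝ) : ∃ ℓ : deltaDomain N α →ₗ[ℝ] ℝ,
    ∀ (Ψ : deltaDomain N α) (i : Fin N), HasVertexValue ((Ψ : GraphL2 N) i) (ℓ Ψ) := by
  have hex : ∀ Ψ : deltaDomain N α, ∃ c, ∀ i, HasVertexValue ((Ψ : GraphL2 N) i) c := by
    rintro ⟨Ψ, Ψ', Ψ'', -, -, c, -, h, -⟩
    exact ⟨c, h⟩
  choose ℓ hℓ using hex
  set o : Fin N := ⟨0, hN⟩
  exact ⟨⟨⟨ℓ, fun Ψ Φ => (hℓ (Ψ + Φ) o).unique ((hℓ Ψ o).add (hℓ Φ o))⟩,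
    fun r Ψ => (hℓ (r • Ψ) o).unique ((hℓ Ψ o).smul r)⟩, hℓ⟩

/-! ### The soliton tail and its logarithmic derivatives -/

/-- The function `x ↦ tanh(μ √ω (x + a₀))`. -/
def tailTanh (N : ℕ) (α ω μ x : ℝ) : ℝ := Real.tanh (μ * √ω * (x + tailShift N α ω μ))

lemma hasDerivAt_tailTanh (N : ℕ) (α ω μ x : ℝ) :
    HasDerivAt (tailTanh N α ω μ) (μ * √ω * (1 - tailTanh N α ω μ x ^ 2)) x := by
  have hl : HasDerivAt (fun x => μ * √ω * (x + tailShift N α ω μ)) (μ * √ω) x := by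
    simpa using ((hasDerivAt_id x).add_const (tailShift N α ω μ)).const_mul (μ * √ω)
  have h := hl.sinh.div hl.cosh (Real.cosh_pos _).ne'
  have e : tailTanh N α ω μ = fun x => Real.sinh (μ * √ω * (x + tailShift N α ω μ))
      / Real.cosh (μ * √ω * (x + tailShift N α ω μ)) := by
    funext x
    exact Real.tanh_eq_sinh_div_cosh _
  rw [e]
  refine h.congr_deriv ?_
  have := (Real.cosh_pos (μ * √ω * (x + tailShift N α ω μ))).ne'
  field_simp

lemma continuous_tailTanh (N : ℕ) (α ω μ : ℝ) : Continuous (tailTanh N α ω μ) :=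
  continuous_iff_continuousAt.2 fun x => (hasDerivAt_tailTanh N α ω μ x).continuousAt

lemma abs_tailTanh_lt_one (N : ℕ) (α ω μ x : ℝ) : |tailTanh N α ω μ x| < 1 :=
  Real.abs_tanh_lt_one _

lemma neg_div_lt_sqrt (hN : 0 < N) (hω : α ^ 2 / (N : ℝ) ^ 2 < ω) :
    -α < N * √ω := by
  have hN' : (0 : ℝ) < N := by exact_mod_cast hN
  have h : -α / N < √ω := by
    refine Real.lt_sqrt_of_sq_lt ?_
    rwa [div_pow, neg_sq]
  rw [div_lt_iff₀ hN'] at h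
  linarith

/-- The defining property of `a₀`, equivalent to the derivative condition for the ground state. The
bound on `ω` puts the argument of `artanh` in `(0, 1)`. -/
lemma sqrt_mul_tailTanh_zero (hN : 0 < N) (hα : α < 0) (hμ : 0 < μ) (hω₀ : 0 < ω)
    (hω : α ^ 2 / (N : ℝ) ^ 2 < ω) : N * (√ω * tailTanh N α ω μ 0) = -α := by
  have hN' : (0 : ℝ) < N := by exact_mod_cast hN
  have hs : 0 < √ω := Real.sqrt_pos.2 hω₀
  have hlt := neg_div_lt_sqrt hN hω
  have e1 : α / ((0 - (N : ℝ)) * √ω) = -α / (N * √ω) := by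
    rw [zero_sub, neg_mul, div_neg, neg_div]
  have hpos : 0 < -α / (N * √ω) := div_pos (by linarith) (by positivity)
  have hlt1 : -α / (N * √ω) < 1 := by rwa [div_lt_one (by positivity)]
  have e2 : μ * √ω * (0 + tailShift N α ω μ) = Real.artanh (-α / (N * √ω)) := by
    rw [tailShift, e1]
    field_simp
    ring
  rw [tailTanh, e2, Real.tanh_artanh ⟨by linarith, hlt1⟩]
  field_simp

lemma tailTanh_zero_pos (hN : 0 < N) (hα : α < 0) (hμ : 0 < μ) (hω₀ : 0 < ω)
    (hω : α ^ 2 / (N : ℝ) ^ 2 < ω) : 0 < tailTanh N α ω μ 0 := by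
  have hN' : (0 : ℝ) < N := by exact_mod_cast hN
  have hs : 0 < √ω := Real.sqrt_pos.2 hω₀
  have := sqrt_mul_tailTanh_zero hN hα hμ hω₀ hω
  by_contra h
  have h1 : N * (√ω * tailTanh N α ω μ 0) ≤ 0 :=
    mul_nonpos_of_nonneg_of_nonpos hN'.le (mul_nonpos_of_nonneg_of_nonpos hs.le (not_lt.1 h))
  linarith

lemma tailTanh_mono (hμ : 0 < μ) : Monotone (tailTanh N α ω μ) := by
  refine monotone_of_deriv_nonneg
    (fun x => (hasDerivAt_tailTanh N α ω μ x).differentiableAt) fun x => ?_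
  rw [(hasDerivAt_tailTanh N α ω μ x).deriv]
  have h := abs_tailTanh_lt_one N α ω μ x
  have h2 := (sq_lt_one_iff_abs_lt_one _).2 h
  exact mul_nonneg (mul_nonneg hμ.le (Real.sqrt_nonneg _)) (by linarith)

lemma groundStateFun_pos (hμ : 0 < μ) (hω₀ : 0 < ω) (k : Fin N) (x : ℝ) :
    0 < groundStateFun N α ω μ k x := by
  unfold groundStateFun soliton
  have := Real.cosh_pos (μ * √ω * (x + tailShift N α ω μ))
  positivity

lemma hasDerivAt_groundStateFun (hμ : 0 < μ) (k : Fin N) (x : ℝ) :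
    HasDerivAt (groundStateFun N α ω μ k)
      (-√ω * tailTanh N α ω μ x * groundStateFun N α ω μ k x) x := by
  have hl : HasDerivAt (fun x => μ * √ω * (x + tailShift N α ω μ)) (μ * √ω) x := by
    simpa using ((hasDerivAt_id x).add_const (tailShift N α ω μ)).const_mul (μ * √ω)
  have hc := Real.cosh_pos (μ * √ω * (x + tailShift N α ω μ))
  have hinv : HasDerivAt (fun x => 1 / Real.cosh (μ * √ω * (x + tailShift N α ω μ))) _ x :=
    (hasDerivAt_const x (1 : ℝ)).div hl.cosh hc.ne'
  have hp := (hinv.rpow_const (p := 1 / μ) (Or.inl (by positivity))).const_mul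
    (((μ + 1) * ω) ^ (1 / (2 * μ)))
  refine hp.congr_deriv ?_
  have e : (1 / Real.cosh (μ * √ω * (x + tailShift N α ω μ))) ^ (1 / μ - 1)
      = (1 / Real.cosh (μ * √ω * (x + tailShift N α ω μ))) ^ (1 / μ)
        * Real.cosh (μ * √ω * (x + tailShift N α ω μ)) := by
    rw [Real.rpow_sub (by positivity), Real.rpow_one]
    field_simp
  rw [e]
  unfold groundStateFun soliton tailTanh
  rw [Real.tanh_eq_sinh_div_cosh]
  field_simp
  ring

lemma abs_groundStateFun_rpow (hμ : 0 < μ) (hω₀ : 0 < ω) (k : Fin N) (x : ℝ) :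
    |groundStateFun N α ω μ k x| ^ (2 * μ) = tailPotential N α ω μ x := by
  rw [abs_of_pos (groundStateFun_pos hμ hω₀ k x)]
  unfold groundStateFun soliton tailPotential
  have hc := Real.cosh_pos (μ * √ω * (x + tailShift N α ω μ))
  have hb : 0 ≤ (μ + 1) * ω := by positivity
  rw [Real.mul_rpow (by positivity) (by positivity), ← Real.rpow_mul hb,
    ← Real.rpow_mul (by positivity)]
  have e1 : 1 / (2 * μ) * (2 * μ) = 1 := by field_simp
  have e2 : 1 / μ * (2 * μ) = (2 : ℕ) := by field_simp; norm_num
  rw [e1, e2, Real.rpow_one, Real.rpow_natCast, Real.tanh_eq_sinh_div_cosh, div_pow, div_pow,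
    one_pow, Real.cosh_sq']
  have : (1 + Real.sinh (μ * √ω * (x + tailShift N α ω μ)) ^ 2) ≠ 0 := by positivity
  field_simp
  ring

lemma tailPotential_eq (N : ℕ) (α ω μ x : ℝ) :
    tailPotential N α ω μ x = (μ + 1) * ω * (1 - tailTanh N α ω μ x ^ 2) := rfl

lemma isRiccati_plus (hμ : 0 < μ) (hω₀ : 0 < ω) (k : Fin N) :
    IsRiccati (fun x => ω - 1 * tailPotential N α ω μ x) (fun x => -√ω * tailTanh N α ω μ x)
      (groundStateFun N α ω μ k) where
  hasDerivAt x _ := by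
    refine ((hasDerivAt_tailTanh N α ω μ x).const_mul (-√ω)).congr_deriv ?_
    rw [tailPotential_eq]
    have := Real.sq_sqrt hω₀.le
    linear_combination (-μ * (1 - tailTanh N α ω μ x ^ 2) + tailTanh N α ω μ x ^ 2) * this
  continuousOn := by
    have := continuous_tailTanh N α ω μ
    simp only [tailPotential_eq]
    fun_prop
  bounded := by
    refine ⟨√ω, fun x _ => ?_⟩
    rw [abs_mul, abs_neg, abs_of_nonneg (Real.sqrt_nonneg ω)]
    exact mul_le_of_le_one_right (Real.sqrt_nonneg ω) (abs_tailTanh_lt_one N α ω μ x).le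
  sol_hasDerivAt x _ := hasDerivAt_groundStateFun hμ k x
  sol_pos x _ := groundStateFun_pos hμ hω₀ k x
  sol_memLp := memLp_groundStateFun N α hω₀ hμ k

/-- The solution is `-φ'/√ω`, which solves the differentiated soliton equation. With `T` the tanh,
`ρ = T'/T + φ'/φ`; this stays bounded because `T` is increasing and already positive at the vertex.
-/
lemma isRiccati_minus (hα : α < 0) (hμ : 0 < μ) (hω₀ : 0 < ω)
    (hω : α ^ 2 / (N : ℝ) ^ 2 < ω) (k : Fin N) :
    IsRiccati (fun x => ω - (2 * μ + 1) * tailPotential N α ω μ x)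
      (fun x => -√ω * ((μ + 1) * tailTanh N α ω μ x - μ * (tailTanh N α ω μ x)⁻¹))
      (fun x => tailTanh N α ω μ x * groundStateFun N α ω μ k x) := by
  have hN : 0 < N := Fin.pos k
  have h0 := tailTanh_zero_pos hN hα hμ hω₀ hω
  have hle : ∀ x, 0 ≤ x → tailTanh N α ω μ 0 ≤ tailTanh N α ω μ x := fun x hx =>
    tailTanh_mono hμ hx
  have hpos : ∀ x, 0 ≤ x → 0 < tailTanh N α ω μ x := fun x hx => h0.trans_le (hle x hx)
  have hsq := Real.sq_sqrt hω₀.le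
  refine ⟨fun x hx => ?_, ?_, ?_, fun x hx => ?_, fun x hx => ?_, ?_⟩
  · have hT := hasDerivAt_tailTanh N α ω μ x
    have hx' := (hpos x hx).ne'
    refine (((hT.const_mul (μ + 1)).sub ((hT.fun_inv hx').const_mul μ)).const_mul
      (-√ω)).congr_deriv ?_
    rw [tailPotential_eq]
    generalize tailTanh N α ω μ x = τ at *
    generalize √ω = s at *
    subst hsq
    field_simp
    ring
  · have := continuous_tailTanh N α ω μ
    simp only [tailPotential_eq]
    fun_prop
  · refine ⟨√ω * ((μ + 1) * 1 + μ * (tailTanh N α ω μ 0)⁻¹), fun x hx => ?_⟩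
    rw [abs_mul, abs_neg, abs_of_nonneg (Real.sqrt_nonneg ω)]
    refine mul_le_mul_of_nonneg_left ((abs_sub _ _).trans (add_le_add ?_ ?_)) (Real.sqrt_nonneg ω)
    · rw [abs_mul, abs_of_pos (by linarith : 0 < μ + 1)]
      exact mul_le_mul_of_nonneg_left (abs_tailTanh_lt_one N α ω μ x).le (by linarith)
    · rw [abs_mul, abs_of_pos hμ, abs_of_pos (inv_pos.2 (hpos x hx))]
      exact mul_le_mul_of_nonneg_left (inv_anti₀ h0 (hle x hx)) hμ.le
  · refine ((hasDerivAt_tailTanh N α ω μ x).mul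
      (hasDerivAt_groundStateFun hμ k x)).congr_deriv ?_
    have hx' := (hpos x hx).ne'
    field_simp
    ring
  · exact mul_pos (hpos x hx) (groundStateFun_pos hμ hω₀ k x)
  · refine (memLp_groundStateFun N α hω₀ hμ k).mono
      ((continuous_tailTanh N α ω μ).mul
        (continuous_groundStateFun N α ω hμ k)).aestronglyMeasurable (ae_of_all _ fun x => ?_)
    rw [norm_mul, Real.norm_eq_abs (tailTanh N α ω μ x)]
    exact mul_le_of_le_one_left (norm_nonneg _) (abs_tailTanh_lt_one N α ω μ x).le

lemma tailPotential_pos (hμ : 0 < μ) (hω₀ : 0 < ω) (x : ℝ) : 0 < tailPotential N α ω μ x := by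
  rw [tailPotential_eq]
  have h := (sq_lt_one_iff_abs_lt_one _).2 (abs_tailTanh_lt_one N α ω μ x)
  exact mul_pos (by positivity) (by linarith)

lemma tailPotential_le (hμ : 0 < μ) (hω₀ : 0 < ω) (x : ℝ) :
    tailPotential N α ω μ x ≤ (μ + 1) * ω := by
  rw [tailPotential_eq]
  have : 0 ≤ (μ + 1) * ω * tailTanh N α ω μ x ^ 2 := by positivity
  linarith

lemma memLp_bounded_mul_groundStateFun (hμ : 0 < μ) (hω₀ : 0 < ω) (k : Fin N) {Q : ℝ → ℝ}
    (hQ : Continuous Q) {C : ℝ} (hC : ∀ x, |Q x| ≤ C) :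
    MemLp (fun x => Q x * groundStateFun N α ω μ k x) 2 halfLine :=
  (memLp_groundStateFun N α hω₀ hμ k).mul'
    (memLp_top_of_bound hQ.aestronglyMeasurable C (ae_of_all _ hC))

lemma exists_isRepr_groundState (α : ℝ) (hμ : 0 < μ) (hω₀ : 0 < ω) (k : Fin N) :
    ∃ f' f'' : EdgeL2, IsRepr (groundState N α hω₀ hμ k) f' f'' (groundStateFun N α ω μ k)
        (fun x => -√ω * tailTanh N α ω μ x * groundStateFun N α ω μ k x) ∧
      f'' =ᵐ[halfLine] fun x =>
        (ω - 1 * tailPotential N α ω μ x) * groundStateFun N α ω μ k x := by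
  have H := isRiccati_plus (α := α) hμ hω₀ k
  have hT := continuous_tailTanh N α ω μ
  have hQ : Continuous fun x => ω - 1 * tailPotential N α ω μ x := by
    simp only [tailPotential_eq]
    fun_prop
  have m1 := memLp_bounded_mul_groundStateFun (α := α) hμ hω₀ k
    (hT.const_mul (-√ω)) (C := √ω) (fun x => by
      rw [abs_mul, abs_neg, abs_of_nonneg (Real.sqrt_nonneg ω)]
      exact mul_le_of_le_one_right (Real.sqrt_nonneg ω) (abs_tailTanh_lt_one N α ω μ x).le)
  have m2 := memLp_bounded_mul_groundStateFun (α := α) hμ hω₀ k hQ (C := ω + (μ + 1) * ω)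
    (fun x => by
      rw [one_mul, abs_le]
      constructor <;> linarith [tailPotential_pos (N := N) (α := α) hμ hω₀ x,
        tailPotential_le (N := N) (α := α) hμ hω₀ x])
  refine ⟨m1.toLp _, m2.toLp _, IsRepr.of_hasDerivAt (memLp_groundStateFun N α hω₀ hμ k) m1 m2
    H.sol_hasDerivAt (fun x hx => ?_) (hQ.mul (continuous_groundStateFun N α ω hμ k)).continuousOn,
    m2.coeFn_toLp⟩
  refine ((H.hasDerivAt x hx).mul (H.sol_hasDerivAt x hx)).congr_deriv ?_
  ring

lemma exists_isDeltaData_groundState (hN : 0 < N) (hα : α < 0) (hμ : 0 < μ) (hω₀ : 0 < ω)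
    (hω : α ^ 2 / (N : ℝ) ^ 2 < ω) : ∃ Ψ' Ψ'' : GraphL2 N,
      IsDeltaData α (groundState N α hω₀ hμ) Ψ' Ψ'' ∧ ∀ k, Ψ'' k =ᵐ[halfLine] fun x =>
        (ω - 1 * tailPotential N α ω μ x) * groundStateFun N α ω μ k x := by
  choose f' f'' hf hf'' using exists_isRepr_groundState (N := N) α hμ hω₀
  refine ⟨WithLp.toLp 2 f', WithLp.toLp 2 f'',
    isDeltaData_of_isRepr (c := soliton μ ω (0 + tailShift N α ω μ)) hf (fun i => rfl) ?_, hf''⟩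
  have := sqrt_mul_tailTanh_zero hN hα hμ hω₀ hω
  have e : ∀ i : Fin N, groundStateFun N α ω μ i 0 = soliton μ ω (0 + tailShift N α ω μ) :=
    fun _ => rfl
  simp only [e, Finset.sum_const, Finset.card_univ, Fintype.card_fin, nsmul_eq_mul]
  linear_combination (-soliton μ ω (0 + tailShift N α ω μ)) * this

/-! ### Kernels, positivity and Morse index -/

lemma groundState_mem_opKernel (hN : 0 < N) (hα : α < 0) (hμ : 0 < μ) (hω₀ : 0 < ω)
    (hω : α ^ 2 / (N : ℝ) ^ 2 < ω) :
    groundState N α hω₀ hμ ∈ opKernel (Lplus N α ω hμ) := by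
  obtain ⟨Ψ', Ψ'', h, h''⟩ := exists_isDeltaData_groundState hN hα hμ hω₀ hω
  refine mem_opKernel_iff.2 ⟨⟨_, _, h⟩, PiLp.ext fun k => Lp.ext ?_⟩
  refine (linearized_apply_ae hμ (abs_groundStateFun_rpow hμ hω₀)
    (⟨_, _, _, h⟩ : (Lplus N α ω hμ).domain) h k).trans ?_
  have hG : groundState N α hω₀ hμ k =ᵐ[halfLine] groundStateFun N α ω μ k :=
    (memLp_groundStateFun N α hω₀ hμ k).coeFn_toLp
  filter_upwards [h'' k, hG, Lp.coeFn_zero ℝ 2 halfLine] with x h1 h2 h3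
  rw [h1, h2]
  refine Eq.trans ?_ h3.symm
  simp

lemma opKernel_Lplus (hN : 0 < N) (hα : α < 0) (hμ : 0 < μ) (hω₀ : 0 < ω)
    (hω : α ^ 2 / (N : ℝ) ^ 2 < ω) :
    opKernel (Lplus N α ω hμ) = Submodule.span ℝ {groundState N α hω₀ hμ} := by
  refine le_antisymm (fun Ψ hΨ => ?_) ?_
  · set o : Fin N := ⟨0, hN⟩
    obtain ⟨c, hc, -⟩ := exists_edge_of_mem_opKernel hμ (abs_groundStateFun_rpow hμ hω₀)
      (isRiccati_plus (α := α) hμ hω₀ o) hΨ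
    refine Submodule.mem_span_singleton.2 ⟨c / groundStateFun N α ω μ o 0, ?_⟩
    refine PiLp.ext fun k => Lp.ext ?_
    refine (Lp.coeFn_smul _ (groundState N α hω₀ hμ k)).trans ?_
    have hG : groundState N α hω₀ hμ k =ᵐ[halfLine] groundStateFun N α ω μ k :=
      (memLp_groundStateFun N α hω₀ hμ k).coeFn_toLp
    filter_upwards [hc k, hG] with x h1 h2
    rw [Pi.smul_apply, h1, h2]
    rfl
  · rw [Submodule.span_singleton_le_iff_mem]
    exact groundState_mem_opKernel hN hα hμ hω₀ hω

lemma riccati_minus_zero (hN : 0 < N) (hα : α < 0) (hμ : 0 < μ) (hω₀ : 0 < ω)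
    (hω : α ^ 2 / (N : ℝ) ^ 2 < ω) :
    α - N * (-√ω * ((μ + 1) * tailTanh N α ω μ 0 - μ * (tailTanh N α ω μ 0)⁻¹)) ≠ 0 := by
  have hN' : (0 : ℝ) < N := by exact_mod_cast hN
  have h0 := tailTanh_zero_pos hN hα hμ hω₀ hω
  have h1 := sqrt_mul_tailTanh_zero hN hα hμ hω₀ hω
  have h2 := (sq_lt_one_iff_abs_lt_one _).2 (abs_tailTanh_lt_one N α ω μ 0)
  have hs : 0 < √ω := Real.sqrt_pos.2 hω₀
  -- Eliminating `α` through `α = -N √ω τ`, with `τ` the tanh at the vertex, leaves a multiple of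
  -- `τ² - 1`, nonzero since `0 < τ < 1`.
  have e : α - N * (-√ω * ((μ + 1) * tailTanh N α ω μ 0 - μ * (tailTanh N α ω μ 0)⁻¹))
      = N * √ω * μ * (tailTanh N α ω μ 0 ^ 2 - 1) / tailTanh N α ω μ 0 := by
    generalize tailTanh N α ω μ 0 = τ at *
    rw [show α = -(N * (√ω * τ)) by linarith]
    field_simp
    ring
  rw [e]
  have : tailTanh N α ω μ 0 ^ 2 - 1 ≠ 0 := by linarith
  positivity

lemma opKernel_Lminus (hN : 0 < N) (hα : α < 0) (hμ : 0 < μ) (hω₀ : 0 < ω)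
    (hω : α ^ 2 / (N : ℝ) ^ 2 < ω) : opKernel (Lminus N α ω hμ) = ⊥ := by
  rw [Submodule.eq_bot_iff]
  intro Ψ hΨ
  obtain ⟨c, hc, hz⟩ := exists_edge_of_mem_opKernel hμ (abs_groundStateFun_rpow hμ hω₀)
    (isRiccati_minus hα hμ hω₀ hω ⟨0, hN⟩) hΨ
  have hc0 : c = 0 := (mul_eq_zero.1 hz).resolve_right (riccati_minus_zero hN hα hμ hω₀ hω)
  refine PiLp.ext fun k => Lp.ext ((hc k).trans ?_)
  filter_upwards [Lp.coeFn_zero ℝ 2 halfLine] with x hx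
  refine Eq.trans ?_ hx.symm
  simp [hc0]

lemma Lplus_nonneg (hN : 0 < N) (hα : α < 0) (hμ : 0 < μ) (hω₀ : 0 < ω)
    (hω : α ^ 2 / (N : ℝ) ^ 2 < ω) (Ψ : (Lplus N α ω hμ).domain) :
    0 ≤ inner ℝ (Lplus N α ω hμ Ψ) (Ψ : GraphL2 N) := by
  obtain ⟨ℓ, hℓ⟩ := exists_vertexValue hN α
  have h := linearized_form hN hμ (abs_groundStateFun_rpow hμ hω₀)
    (isRiccati_plus (α := α) hμ hω₀ ⟨0, hN⟩) Ψ (hℓ Ψ)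
  have e : α - N * (-√ω * tailTanh N α ω μ 0) = 0 := by
    linarith [sqrt_mul_tailTanh_zero hN hα hμ hω₀ hω]
  rwa [e, mul_zero] at h

lemma inner_potentialMul_self_le (hμ : 0 < μ) (hω₀ : 0 < ω) (Ψ : GraphL2 N) :
    inner ℝ (potentialMul N α ω hμ Ψ) Ψ ≤ (μ + 1) * ω * ‖Ψ‖ ^ 2 := by
  rw [← real_inner_self_eq_norm_sq, inner_eq_sum_integral, inner_eq_sum_integral, Finset.mul_sum]
  refine Finset.sum_le_sum fun i _ => ?_
  rw [← integral_const_mul]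
  refine integral_mono_ae ((Lp.memLp _).integrable_mul (Lp.memLp _))
    (((Lp.memLp _).integrable_mul (Lp.memLp _)).const_mul _) ?_
  filter_upwards [coeFn_potentialMul (α := α) (ω := ω) hμ Ψ i] with x hx
  rw [hx, abs_groundStateFun_rpow hμ hω₀, mul_assoc]
  exact mul_le_mul_of_nonneg_right (tailPotential_le hμ hω₀ x) (mul_self_nonneg _)

lemma inner_potentialMul_groundState_pos (hN : 0 < N) (hμ : 0 < μ) (hω₀ : 0 < ω) :
    0 < inner ℝ (potentialMul N α ω hμ (groundState N α hω₀ hμ)) (groundState N α hω₀ hμ) := by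
  rw [inner_eq_sum_integral]
  refine Finset.sum_pos (fun i _ => ?_) ⟨⟨0, hN⟩, Finset.mem_univ _⟩
  have hG : groundState N α hω₀ hμ i =ᵐ[halfLine] groundStateFun N α ω μ i :=
    (memLp_groundStateFun N α hω₀ hμ i).coeFn_toLp
  have e : (fun x => potentialMul N α ω hμ (groundState N α hω₀ hμ) i x
      * groundState N α hω₀ hμ i x) =ᵐ[halfLine]
      fun x => tailPotential N α ω μ x * groundStateFun N α ω μ i x ^ 2 := by
    filter_upwards [coeFn_potentialMul (α := α) (ω := ω) hμ (groundState N α hω₀ hμ) i, hG]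
      with x h1 h2
    rw [h1, abs_groundStateFun_rpow hμ hω₀, h2]
    ring
  have hpos : ∀ x, 0 < tailPotential N α ω μ x * groundStateFun N α ω μ i x ^ 2 := fun x =>
    mul_pos (tailPotential_pos hμ hω₀ x) (pow_pos (groundStateFun_pos hμ hω₀ i x) 2)
  rw [integral_congr_ae e, integral_pos_iff_support_of_nonneg (fun x => (hpos x).le)
    (((Lp.memLp _).integrable_mul (Lp.memLp _)).congr e)]
  have : Function.support (fun x => tailPotential N α ω μ x * groundStateFun N α ω μ i x ^ 2)
      = univ := eq_univ_of_forall fun x => (hpos x).ne'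
  rw [this]
  simp

lemma Lminus_apply (hμ : 0 < μ) (Ψ : deltaDomain N α) :
    Lminus N α ω hμ Ψ = Lplus N α ω hμ Ψ - (2 * μ) • potentialMul N α ω hμ (Ψ : GraphL2 N) := by
  obtain ⟨Ψ', Ψ'', h⟩ := Ψ.2
  refine (linearized_apply hμ _ Ψ h).trans ?_
  refine Eq.trans ?_ (congrArg (· - (2 * μ) • potentialMul N α ω hμ (Ψ : GraphL2 N))
    (linearized_apply hμ 1 Ψ h).symm)
  module

lemma morseIndex_Lminus (hN : 0 < N) (hα : α < 0) (hμ : 0 < μ) (hω₀ : 0 < ω)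
    (hω : α ^ 2 / (N : ℝ) ^ 2 < ω) : morseIndex (Lminus N α ω hμ) = 1 := by
  obtain ⟨ℓ, hℓ⟩ := exists_vertexValue hN α
  obtain ⟨hG, hG0⟩ := mem_opKernel_iff.1 (groundState_mem_opKernel hN hα hμ hω₀ hω)
  have hsplit : ∀ Ψ : (Lminus N α ω hμ).domain,
      inner ℝ (Lminus N α ω hμ Ψ) (Ψ : GraphL2 N) = inner ℝ (Lplus N α ω hμ Ψ) (Ψ : GraphL2 N)
        - 2 * μ * inner ℝ (potentialMul N α ω hμ (Ψ : GraphL2 N)) (Ψ : GraphL2 N) := by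
    intro Ψ
    rw [← real_inner_smul_left, ← inner_sub_left]
    exact congrArg (fun v => inner ℝ v (Ψ : GraphL2 N)) (Lminus_apply hμ Ψ)
  -- The lower bound combines `ℒ₊ ≥ 0` with `|Ψ_{ω,0}|^{2μ} ≤ (μ + 1) ω`. The functional is the
  -- vertex value, and the negative direction is the ground state, on which `ℒ₊` vanishes.
  refine morseIndex_eq_one (isSelfAdjoint_linearized hN hμ _) (M := -(2 * μ * ((μ + 1) * ω)))
    (fun Ψ => ?_) ℓ (fun Ψ hΨ => ?_) (x₀ := ⟨groundState N α hω₀ hμ, hG⟩) ?_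
  · refine le_of_le_of_eq ?_ (hsplit Ψ).symm
    have h1 := Lplus_nonneg hN hα hμ hω₀ hω Ψ
    have h2 := mul_le_mul_of_nonneg_left
      (inner_potentialMul_self_le (α := α) hμ hω₀ (Ψ : GraphL2 N)) (by linarith : 0 ≤ 2 * μ)
    linarith
  · have h := linearized_form hN hμ (abs_groundStateFun_rpow hμ hω₀)
      (isRiccati_minus hα hμ hω₀ hω ⟨0, hN⟩) Ψ (hℓ Ψ)
    have h0 : (ℓ : deltaDomain N α → ℝ) Ψ = 0 := hΨ
    rw [h0, zero_pow two_ne_zero, zero_mul] at h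
    exact h
  · refine lt_of_eq_of_lt (hsplit ⟨groundState N α hω₀ hμ, hG⟩) ?_
    change inner ℝ (Lplus N α ω hμ ⟨groundState N α hω₀ hμ, hG⟩) (groundState N α hω₀ hμ)
      - 2 * μ * inner ℝ (potentialMul N α ω hμ (groundState N α hω₀ hμ))
        (groundState N α hω₀ hμ) < 0
    rw [hG0, inner_zero_left]
    have := mul_pos (by linarith : 0 < 2 * μ)
      (inner_potentialMul_groundState_pos (α := α) hN hμ hω₀)
    linarith

end StarGraph

end

theorem proposition6p1 (N : ℕ) (hN : 1 ≤ N) (α ω μ : ℝ) (hα : α < 0) (hμ : 0 < μ)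
    (hω₀ : 0 < ω) (hω : α ^ 2 / (N : ℝ) ^ 2 < ω) :
    (IsSelfAdjoint (StarGraph.Lminus N α ω hμ) ∧ IsSelfAdjoint (StarGraph.Lplus N α ω hμ)) ∧
    (StarGraph.opKernel (StarGraph.Lplus N α ω hμ)
        = Submodule.span ℝ {StarGraph.groundState N α hω₀ hμ} ∧
      ∀ t ∈ StarGraph.opSpectrum (StarGraph.Lplus N α ω hμ), t ≠ 0 → 0 < t) ∧
    StarGraph.opKernel (StarGraph.Lminus N α ω hμ) = ⊥ ∧
    StarGraph.morseIndex (StarGraph.Lminus N α ω hμ) = 1 := by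
  have hN' : 0 < N := hN
  refine ⟨⟨StarGraph.isSelfAdjoint_linearized hN' hμ _,
    StarGraph.isSelfAdjoint_linearized hN' hμ _⟩,
    ⟨StarGraph.opKernel_Lplus hN' hα hμ hω₀ hω, fun t ht ht0 => ?_⟩,
    StarGraph.opKernel_Lminus hN' hα hμ hω₀ hω, StarGraph.morseIndex_Lminus hN' hα hμ hω₀ hω⟩
  by_contra hneg
  exact ht (StarGraph.mem_resolventSet_of_neg (StarGraph.isSelfAdjoint_linearized hN' hμ 1)
    (StarGraph.Lplus_nonneg hN' hα hμ hω₀ hω) (lt_of_le_of_ne (not_lt.1 hneg) ht0))
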